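/- Assume $\mathrm{MA}_{\aleph_1}$. Let $\mathcal F$ be a family of at most $\aleph_1$ linear orders, each of which is strongly surjective, where a linear order $A$ is strongly surjective if for every nonempty linear order $B$ that embeds into $A$ there is a monotone surjection from $A$ onto $B$. Then there are a normal Countryman line $C$ and a $C$-mixed sum $L=\sum_{c\in C}A_c$ such that $L$ is strongly surjective, every order in $\mathcal F$ embeds into $L$, and $|L|=\max\{\aleph_1,\sup_{A\in\mathcal F}|A|\}$ (with $\sup\varnothing=0$). Moreover every nonempty member of $\mathcal F$ is one of the summands $A_c$, and if $\mathcal F$ has a nonempty member, then all the summands $A_c$ are members of $\mathcal F$. Here a Countryman line is an uncountable linear order $C$ such that $C\times C$ with the coordinatewise order is a union of countably many chains. An Aronszajn line is an uncountable linear order that contains no copy of $\omega_1$, of $\omega_1^\star$, or of an uncountable set of reals. An Aronszajn line $A$ is normal if it satisfies the following two conditions: (i) it is $\aleph_1$-dense, that is, it has no endpoints and $|[a,b]|=\aleph_1$ for all $a<b$; (ii) there is a $\subseteq$-increasing sequence $\langle D_\xi:\xi<\omega_1\rangle$ of countable subsets covering $A$, with $D_\xi=\bigcup_{\eta<\xi}D_\eta$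 at limit $\xi$, such that for every $\xi<\omega_1$ no maximal nonempty convex subset of $A\setminus D_\xi$ has a minimum or a maximum. In (ii), convexity is understood in $A$. A $C$-mixed sum is a lexicographic sum $\sum_{c\in C}A_c$ of nonempty linear orders over the dense order $C$ such that for every $c\in C$ the set $\{d\in C: A_d=A_c\}$ is dense in $C$. -/

import Mathlib

open scoped Cardinal Ordinal

universe u v

/-! ### Martin's Axiom -/

/-- The countable chain condition for a forcing notion: every set of pairwise incompatible
conditions is countable. -/
def IsCCC (P : Type u) [Preorder P] : Prop :=
  ∀ S : Set P, (∀ p ∈ S, ∀ q ∈ S, p ≠ q → ¬ ∃ r : P, r ≤ p ∧ r ≤ q) → S.Countable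

/-- Density of a set of conditions in a forcing notion. -/
def IsForcingDense {P : Type u} [Preorder P] (D : Set P) : Prop :=
  ∀ p : P, ∃ q ∈ D, q ≤ p

/-- Martin's Axiom for `κ` dense sets: for every nonempty ccc preorder and every family of at most
`κ` dense sets there is a filter that meets all of them. -/
def MartinsAxiom (κ : Cardinal.{0}) : Prop :=
  ∀ (P : Type) [Preorder P] [Nonempty P], IsCCC P →
    ∀ 𝒟 : Set (Set P), #𝒟 ≤ κ → (∀ D ∈ 𝒟, IsForcingDense D) →
      ∃ G : Order.PFilter P, ∀ D ∈ 𝒟, ∃ p ∈ D, p ∈ G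

/-! ### Embeddings, epimorphisms and strongly surjective orders -/

/-- `A ⪯ B`: the order `A` embeds into `B`, i.e. `A` is a suborder of `B`. -/
def Embeds (A : Type u) (B : Type v) [LinearOrder A] [LinearOrder B] : Prop :=
  Nonempty (A ↪o B)

/-- `A ⊴ B`: `A` is empty or there is an epimorphism (monotone surjection) from `B` onto `A`. -/
def EpiBelow (A : Type u) (B : Type v) [LinearOrder A] [LinearOrder B] : Prop :=
  IsEmpty A ∨ ∃ f : B → A, Monotone f ∧ Function.Surjective f

/-- `A` is strongly surjective: `B ⊴ A` for every suborder `B` of `A`. -/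
def StronglySurjective (A : Type u) [LinearOrder A] : Prop :=
  ∀ (B : Type u) [LinearOrder B], Embeds B A → EpiBelow B A

/-! ### Aronszajn, Countryman and normal lines -/

/-- An Aronszajn line: an uncountable linear order without copies of `ω₁`, of its reverse, or of
an uncountable set of reals. -/
def IsAronszajnLine (A : Type u) [LinearOrder A] : Prop :=
  Uncountable A ∧ ¬ Embeds (Set.Iio (ω₁ : Ordinal.{0})) A ∧
    ¬ Embeds (Set.Iio (ω₁ : Ordinal.{0}))ᵒᵈ A ∧
    ∀ S : Set ℝ, ¬ S.Countable → ¬ Embeds S A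

/-- A Countryman line: an uncountable linear order `C` such that `C × C`, with the coordinatewise
order, is a union of countably many chains. -/
def IsCountrymanLine (C : Type u) [LinearOrder C] : Prop :=
  Uncountable C ∧
    ∃ S : ℕ → Set (C × C), (∀ n, IsChain (· ≤ ·) (S n)) ∧ ⋃ n, S n = Set.univ

/-- `κ`-density: nonempty, without endpoints, and all `[a, b]` with `a < b` have size `κ`. -/
def IsCardDense (κ : Cardinal.{u}) (A : Type u) [LinearOrder A] : Prop :=
  Nonempty A ∧ NoMinOrder A ∧ NoMaxOrder A ∧ ∀ a b : A, a < b → #(Set.Icc a b) = κ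

/-- A decomposition of `A`: an increasing continuous `ω₁`-sequence of countable subsets
covering `A`. Only the values `D ξ` with `ξ < ω₁` matter. -/
structure IsDecomposition {A : Type u} (D : Ordinal.{0} → Set A) : Prop where
  countable : ∀ ξ < ω₁, (D ξ).Countable
  mono : ∀ ξ η : Ordinal.{0}, ξ ≤ η → η < ω₁ → D ξ ⊆ D η
  continuous : ∀ ξ < ω₁, Order.IsSuccLimit ξ → D ξ = ⋃ η < ξ, D η
  cover : ∀ a : A, ∃ ξ < ω₁, a ∈ D ξ

/-- `I` is a complementary interval of `A \ X`: an interval (nonempty convex set) that is maximal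
among those without points in `X`. -/
def IsComplementaryInterval {A : Type u} [LinearOrder A] (X I : Set A) : Prop :=
  Maximal (fun J : Set A => J.Nonempty ∧ J.OrdConnected ∧ Disjoint J X) I

/-- Non-stationarity: some decomposition has all its complementary intervals without endpoints. -/
def IsNonStationary (A : Type u) [LinearOrder A] : Prop :=
  ∃ D : Ordinal.{0} → Set A, IsDecomposition D ∧
    ∀ ξ < ω₁, ∀ I : Set A, IsComplementaryInterval (D ξ) I →
      (¬ ∃ a, IsLeast I a) ∧ ¬ ∃ a, IsGreatest I a

/-- A normal Aronszajn line: non-stationary and `ℵ₁`-dense. -/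
def IsNormalLine (A : Type u) [LinearOrder A] : Prop :=
  IsAronszajnLine A ∧ IsNonStationary A ∧ IsCardDense ℵ₁ A

/-! ### Mixed sums -/

/-- The family `A` of linear orders indexed by the dense order `I` defines an `I`-mixed sum
`Σₗ i, A i`: each summand is nonempty and occurs on a dense set of indices. -/
def IsMixed {I : Type u} [LinearOrder I] (A : I → LinOrd.{v}) : Prop :=
  DenselyOrdered I ∧ (∀ i, Nonempty (A i)) ∧
    ∀ i : I, ∀ x y : I, x < y → ∃ j : I, x < j ∧ j < y ∧ A i = A j

/-! A sum over `C` of strongly surjective orders is strongly surjective as soon as `C` is so in a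
coloured sense. Let `B` be a suborder of the sum and `D` the set of indices that `B` meets, so `B`
is a sum over `D` of parts `B_d` of `A_d`. Suppose that `C` maps monotonically onto `D` and that the
fibre of `d` has a ℤ-sequence, cofinal and coinitial in it, of indices with summand `A_d`. Strongly
surjective orders contain neither `ω₁` nor its reverse, so `B_d` is covered by intervals `[b_n,
b_(n+1)]` with `n` in ℤ. The `n`-th copy of `A_d` is mapped onto the `n`-th interval and the
summands in between are collapsed to endpoints; this maps the fibre onto `B_d`
(`exists_epi_of_int_seq`, `HasFatFibers.stronglySurjective`).

Such a `C` is found among rational-valued functions of countable length that are finite-to-one and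
coherent modulo finite sets, ordered lexicographically. Coherence makes the square of this order a
union of countably many chains (`lt_of_profile_eq`). For a prefix-free set `D` of such points,
`fatten D` replaces each `d` by many extensions of it. The last value of an extension encodes a
colour in `ω₁`, and the colour selects the summand. By construction `fatten D` projects onto `D`
with fibres of the required kind (`exists_projection`).

The core is that under Martin's Axiom all fattened nonempty prefix-free sets are isomorphic by
colour-preserving maps (`exists_colour_iso`). With `C = fatten {root}`, every nonempty `D ⊆ C` is
again prefix-free, so `C ≅ fatten D → D` is the desired map. The forcing consists of finite partial
isomorphisms that also preserve agreement below the levels of a club. Its chain condition comes from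
a Δ-system argument (`exists_separated`, `exists_match_union`), the density of its requirements from
the choice of the club (`exists_match`). -/

/-! ### The well-order `ω₁` as a type -/

/-- The canonical well-order of type `ω₁`. -/
abbrev OmegaOne : Type := (ω₁ : Ordinal.{0}).ToType

noncomputable instance : OrderBot OmegaOne := by
  have : Nonempty OmegaOne := Ordinal.nonempty_toType_iff.2 (Ordinal.omega_pos 1).ne'
  exact WellFoundedLT.toOrderBot _

namespace OmegaOne

theorem mk_eq : #OmegaOne = ℵ₁ := by simp

instance : Uncountable OmegaOne := by
  rw [← Cardinal.aleph0_lt_mk_iff, mk_eq]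
  exact Cardinal.aleph0_lt_aleph_one

theorem countable_Iio (a : OmegaOne) : (Set.Iio a).Countable := by
  rw [← Cardinal.le_aleph0_iff_set_countable, ← Order.lt_succ_iff, Cardinal.succ_aleph0, ← mk_eq]
  exact Cardinal.mk_Iio_lt a (by rw [mk_eq]; simp)

theorem countable_Iic (a : OmegaOne) : (Set.Iic a).Countable := by
  rw [← Set.Iio_insert]
  exact (countable_Iio a).insert a

theorem exists_gt_of_countable {S : Set OmegaOne} (hS : S.Countable) : ∃ b, ∀ s ∈ S, s < b := by
  by_contra! h
  refine Set.not_countable_univ (α := OmegaOne)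
    ((hS.biUnion fun s _ => countable_Iic s).mono fun b _ => ?_)
  obtain ⟨s, hs, hb⟩ := h b
  exact Set.mem_biUnion hs hb

instance : NoMaxOrder OmegaOne :=
  ⟨fun a => (exists_gt_of_countable (Set.countable_singleton a)).imp fun _ h => h a rfl⟩

theorem not_countable_Ioi (a : OmegaOne) : ¬ (Set.Ioi a).Countable := fun h =>
  Set.not_countable_univ (α := OmegaOne) (by
    rw [← Set.Iic_union_Ioi (a := a)]
    exact (countable_Iic a).union h)

theorem exists_enum (a : OmegaOne) : ∃ s : ℕ → OmegaOne, Set.Iic a = Set.range s :=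
  (countable_Iic a).exists_eq_range ⟨a, Set.self_mem_Iic⟩

/-- An enumeration of the initial segment of the elements up to `a`. -/
noncomputable def enum (a : OmegaOne) : ℕ → OmegaOne := (exists_enum a).choose

theorem range_enum (a : OmegaOne) : Set.Iic a = Set.range (enum a) := (exists_enum a).choose_spec

theorem enum_le (a : OmegaOne) (n : ℕ) : enum a n ≤ a := by
  have : enum a n ∈ Set.Iic a := range_enum a ▸ Set.mem_range_self n
  exact this

theorem exists_enum_eq {a b : OmegaOne} (h : b ≤ a) : ∃ n, enum a n = b := by
  have : b ∈ Set.range (enum a) := range_enum a ▸ Set.mem_Iic.2 h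
  exact this

open Classical in
/-- A coherent sequence of finite-to-one functions on the countable ordinals. -/
noncomputable def ladder (h : OmegaOne) : OmegaOne → ℕ := fun ξ =>
  let n := sInf {n | ξ ≤ enum h n ∧ enum h n < h}
  -- The test ensures termination. For `ξ < h` it always succeeds, because `ξ` itself is a candidate
  -- for `enum h n`.
  if _ : enum h n < h then
    max (if ξ < enum h n then ladder (enum h n) ξ else 0) n
  else 0
termination_by h

theorem ladder_eq {h ξ : OmegaOne} (hξ : ξ < h) : ∃ n, (ξ ≤ enum h n ∧ enum h n < h) ∧
    (∀ m, ξ ≤ enum h m → enum h m < h → n ≤ m) ∧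
    ladder h ξ = max (if ξ < enum h n then ladder (enum h n) ξ else 0) n := by
  have hne : {n | ξ ≤ enum h n ∧ enum h n < h}.Nonempty := by
    obtain ⟨n, hn⟩ := exists_enum_eq hξ.le
    exact ⟨n, hn.ge, hn ▸ hξ⟩
  have hmem := Nat.sInf_mem hne
  refine ⟨_, hmem, fun m h1 h2 => Nat.sInf_le ⟨h1, h2⟩, ?_⟩
  rw [ladder]
  simp only [dif_pos hmem.2]

/-- A value at most `n` forces the index used in the recursion to be at most `n`, and for each of
these finitely many indices induction applies to `enum h m`. -/
theorem ladder_finite (h : OmegaOne) (n : ℕ) : {ξ | ξ < h ∧ ladder h ξ ≤ n}.Finite := by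
  induction h using WellFoundedLT.induction generalizing n with
  | ind h ih =>
    refine ((Set.finite_Iic n).biUnion (t := fun m => {ξ | enum h m < h ∧
      ((ξ < enum h m ∧ ladder (enum h m) ξ ≤ n) ∨ ξ = enum h m)}) fun m _ => ?_).subset ?_
    · by_cases hm : enum h m < h
      · exact ((ih _ hm n).union (Set.finite_singleton (enum h m))).subset fun ξ hξ => hξ.2
      · simp [hm]
    · rintro ξ ⟨hξ, hn⟩
      obtain ⟨m, hm, -, he⟩ := ladder_eq hξ
      rw [he] at hn
      refine Set.mem_biUnion (x := m) (le_trans (le_max_right _ _) hn) ⟨hm.2, ?_⟩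
      rcases hm.1.lt_or_eq with h1 | h1
      · rw [if_pos h1] at hn
        exact Or.inl ⟨h1, le_trans (le_max_left _ _) hn⟩
      · exact Or.inr h1

/-- If `h = enum k N`, only indices `m ≤ N` occur below `h`. For each of them `ladder k` equals
`ladder (enum k m)` except where the latter is at most `m`, and that function coheres with `ladder
h` by induction. -/
theorem ladder_coherent {h k : OmegaOne} (hk : h ≤ k) :
    {ξ | ξ < h ∧ ladder h ξ ≠ ladder k ξ}.Finite := by
  induction k using WellFoundedLT.induction generalizing h with
  | ind k ih =>
    rcases hk.eq_or_lt with rfl | hk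
    · simp
    obtain ⟨N, hN⟩ := exists_enum_eq hk.le
    refine ((Set.finite_Iic N).biUnion (t := fun m => {ξ | enum k m < k ∧ ξ < h ∧
      ((ξ < enum k m ∧ (ladder (enum k m) ξ ≤ m ∨ ladder h ξ ≠ ladder (enum k m) ξ))
        ∨ ξ = enum k m)}) fun m _ => ?_).subset ?_
    · by_cases hm : enum k m < k
      · have h1 := ladder_finite (enum k m) m
        have h2 : {ξ | ξ < h ∧ ξ < enum k m ∧ ladder h ξ ≠ ladder (enum k m) ξ}.Finite := by
          rcases le_total h (enum k m) with hle | hle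
          · exact (ih _ hm hle).subset fun ξ hξ => ⟨hξ.1, hξ.2.2⟩
          · exact (ih _ hk hle).subset fun ξ hξ => ⟨hξ.2.1, hξ.2.2.symm⟩
        refine ((h1.union h2).union (Set.finite_singleton (enum k m))).subset ?_
        rintro ξ ⟨-, h3, ⟨h4, h5 | h5⟩ | h4⟩
        · exact Or.inl (Or.inl ⟨h4, h5⟩)
        · exact Or.inl (Or.inr ⟨h3, h4, h5⟩)
        · exact Or.inr h4
      · simp [hm]
    · rintro ξ ⟨hξ, hn⟩
      obtain ⟨m, hm, hmin, he⟩ := ladder_eq (hξ.trans hk)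
      refine Set.mem_biUnion (x := m) (hmin N (hN ▸ hξ.le) (hN ▸ hk)) ⟨hm.2, hξ, ?_⟩
      rcases hm.1.lt_or_eq with h1 | h1
      · refine Or.inl ⟨h1, ?_⟩
        rw [he, if_pos h1] at hn
        by_contra! hc
        exact hn (hc.2.trans (max_eq_left hc.1.le).symm)
      · exact Or.inr h1

/-- The ladder functions with non-integral rational values. -/
noncomputable def base (h ξ : OmegaOne) : ℚ := ladder h ξ + 1 / 2

theorem base_finite (h : OmegaOne) (n : ℕ) : {ξ | ξ < h ∧ |base h ξ| ≤ n}.Finite := by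
  refine (ladder_finite h n).subset fun ξ hξ => ⟨hξ.1, ?_⟩
  have h1 := (le_abs_self _).trans hξ.2
  unfold base at h1
  have : (ladder h ξ : ℚ) ≤ n := by linarith
  exact_mod_cast this

theorem base_coherent (h k : OmegaOne) : {ξ | ξ < h ∧ ξ < k ∧ base h ξ ≠ base k ξ}.Finite := by
  rcases le_total h k with hk | hk
  · exact (ladder_coherent hk).subset fun ξ hξ => ⟨hξ.1, fun h => hξ.2.2 (by simp [base, h])⟩
  · exact (ladder_coherent hk).subset fun ξ hξ => ⟨hξ.2.1, fun h => hξ.2.2 (by simp [base, h])⟩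

end OmegaOne

/-- A rational number that is not an integer. -/
def NonInt (q : ℚ) : Prop := ∀ n : ℤ, q ≠ n

theorem NonInt.ne_zero {q : ℚ} (h : NonInt q) : q ≠ 0 := by simpa using h 0

theorem nonInt_int_add_half (n : ℤ) : NonInt ((n : ℚ) + 1 / 2) := by
  intro m h
  have : ((2 * n + 1 : ℤ) : ℚ) = ((2 * m : ℤ) : ℚ) := by push_cast; linarith
  have := Rat.intCast_injective this
  omega

theorem nonInt_nat_add_half (n : ℕ) : NonInt ((n : ℚ) + 1 / 2) := nonInt_int_add_half n

theorem exists_nonInt_between {a b : ℚ} (h : a < b) : ∃ q, NonInt q ∧ a < q ∧ q < b := by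
  obtain ⟨c, hac, hcb⟩ := exists_between (lt_min h (Int.lt_floor_add_one a))
  refine ⟨c, fun n hn => ?_, hac, hcb.trans_le (min_le_left _ _)⟩
  subst hn
  have h1 := hcb.trans_le (min_le_right _ _)
  have h2 : n < ⌊a⌋ + 1 := by exact_mod_cast h1
  have h3 : (n : ℚ) ≤ ⌊a⌋ := by exact_mod_cast Int.lt_add_one_iff.1 h2
  exact absurd (h3.trans (Int.floor_le a)) hac.not_ge


open OmegaOne

/-! ### Coherent points -/

/-- Rational-valued functions of countable length, coherent with the ladder and continued by zero
above their last coordinate. -/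
structure CohPoint where
  val : OmegaOne → ℚ
  ht : OmegaOne
  zero_iff : ∀ ξ, val ξ = 0 ↔ ht < ξ
  coh : {ξ | ξ < ht ∧ val ξ ≠ base ht ξ}.Finite

namespace CohPoint

theorem val_injective : Function.Injective val := by
  rintro ⟨f, h, h1, h2⟩ ⟨g, k, k1, k2⟩ (rfl : f = g)
  have : h = k := by
    by_contra hne
    rcases lt_or_gt_of_ne hne with hlt | hlt
    · exact lt_irrefl _ ((k1 k).1 ((h1 k).2 hlt))
    · exact lt_irrefl _ ((h1 h).1 ((k1 h).2 hlt))
  subst this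
  rfl

noncomputable instance : LinearOrder CohPoint :=
  LinearOrder.lift' (fun z => toLex z.val) fun _ _ h => val_injective (toLex.injective h)

/-- Two points agree below `β`. -/
def Agree (β : OmegaOne) (z w : CohPoint) : Prop := ∀ ξ < β, z.val ξ = w.val ξ

variable {x y z w : CohPoint} {β γ δ ρ h : OmegaOne}

theorem lt_iff : z < w ↔ ∃ δ, Agree δ z w ∧ z.val δ < w.val δ := Iff.rfl

theorem Agree.symm (h : Agree β z w) : Agree β w z := fun ξ hξ => (h ξ hξ).symm

theorem Agree.trans (h : Agree β x y) (h' : Agree β y z) : Agree β x z :=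
  fun ξ hξ => (h ξ hξ).trans (h' ξ hξ)

theorem Agree.mono (h : Agree β x y) (hγ : γ ≤ β) : Agree γ x y := fun ξ hξ => h ξ (hξ.trans_le hγ)

theorem Agree.refl : Agree β x x := fun _ _ => rfl

theorem exists_diff (h : z ≠ w) : ∃ δ, Agree δ z w ∧ z.val δ ≠ w.val δ := by
  have hne : ∃ ξ, z.val ξ ≠ w.val ξ := by
    by_contra! hc
    exact h (val_injective (funext hc))
  obtain ⟨δ, hδ, hmin⟩ := WellFounded.has_min (wellFounded_lt (α := OmegaOne))
    {ξ | z.val ξ ≠ w.val ξ} hne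
  exact ⟨δ, fun ξ hξ => not_not.1 fun hc => hmin ξ hc hξ, hδ⟩

theorem exists_diff_of_not_agree (h : ¬ Agree β z w) : ∃ δ < β, Agree δ z w ∧ z.val δ ≠ w.val δ := by
  obtain ⟨δ, h1, h2⟩ := exists_diff (z := z) (w := w) (by rintro rfl; exact h Agree.refl)
  exact ⟨δ, lt_of_not_ge fun hc => h (h1.mono hc), h1, h2⟩

theorem lt_iff_of_diff (h : Agree δ z w) (hne : z.val δ ≠ w.val δ) :
    z < w ↔ z.val δ < w.val δ := by
  refine ⟨fun hlt => ?_, fun hlt => lt_iff.2 ⟨δ, h, hlt⟩⟩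
  obtain ⟨ε, h1, h2⟩ := lt_iff.1 hlt
  rcases lt_trichotomy ε δ with hε | rfl | hε
  · exact absurd (h ε hε) h2.ne
  · exact h2
  · exact absurd (h1 δ hε) hne

theorem lt_congr_right (h : ¬ Agree ρ x y) (hy : Agree ρ y z) : x < y ↔ x < z := by
  obtain ⟨δ, hδ, h1, h2⟩ := exists_diff_of_not_agree h
  have h3 : Agree δ x z := h1.trans (hy.mono hδ.le)
  rw [lt_iff_of_diff h1 h2, lt_iff_of_diff h3 (hy δ hδ ▸ h2), hy δ hδ]

theorem lt_congr_left (h : ¬ Agree ρ x y) (hy : Agree ρ y z) : y < x ↔ z < x := by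
  obtain ⟨δ, hδ, h1, h2⟩ := exists_diff_of_not_agree h
  have h3 : Agree δ x z := h1.trans (hy.mono hδ.le)
  rw [lt_iff_of_diff h1.symm h2.symm, lt_iff_of_diff h3.symm (hy δ hδ ▸ h2.symm), hy δ hδ]

theorem Agree.of_le_of_le (h : Agree β x z) (hxy : x ≤ y) (hyz : y ≤ z) : Agree β x y := by
  by_contra hc
  have hlt : x < y := lt_of_le_of_ne hxy (by rintro rfl; exact hc Agree.refl)
  have h2 := (lt_congr_left (z := z) (fun h' => hc h'.symm) h).1 hlt
  exact absurd hyz h2.not_ge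

theorem val_ne_zero (h : β ≤ z.ht) : z.val β ≠ 0 := fun hc => ((z.zero_iff β).1 hc).not_ge h

theorem val_ht_ne_zero (z : CohPoint) : z.val z.ht ≠ 0 := val_ne_zero le_rfl

theorem eq_of_agree_of_ht_eq (h : Agree (Order.succ z.ht) z w) (hh : w.ht = z.ht) : z = w := by
  refine val_injective (funext fun ξ => ?_)
  rcases lt_or_ge ξ (Order.succ z.ht) with h1 | h1
  · exact h ξ h1
  · have h1 := Order.succ_le_iff.1 h1
    rw [(z.zero_iff ξ).2 h1, (w.zero_iff ξ).2 (hh ▸ h1)]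

/-- The first zero after the height of `z` lies below `ρ`, so the agreement also fixes the height of
`w`. -/
theorem eq_of_agree (h : Agree ρ z w) (hz : Order.succ z.ht < ρ) : z = w := by
  refine eq_of_agree_of_ht_eq (h.mono hz.le) (le_antisymm ?_ ?_)
  · have := (h _ hz).symm.trans ((z.zero_iff _).2 (Order.lt_succ z.ht))
    exact Order.lt_succ_iff.1 ((w.zero_iff _).1 this)
  · by_contra! hc
    exact val_ht_ne_zero z ((h _ ((Order.lt_succ _).trans hz)).trans ((w.zero_iff _).2 hc))

theorem diff_finite (z w : CohPoint) :
    {ξ | ξ < z.ht ∧ ξ < w.ht ∧ z.val ξ ≠ w.val ξ}.Finite := by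
  refine ((z.coh.union w.coh).union (base_coherent z.ht w.ht)).subset ?_
  rintro ξ ⟨h1, h2, h3⟩
  by_contra hc
  simp only [Set.mem_union, Set.mem_ofPred_eq, not_or, not_and, not_not] at hc
  exact h3 ((hc.1.1 h1).trans ((hc.2 h1 h2).trans (hc.1.2 h2).symm))

theorem bounded_finite (z : CohPoint) (n : ℕ) : {ξ | ξ < z.ht ∧ |z.val ξ| ≤ n}.Finite := by
  refine (z.coh.union (base_finite z.ht n)).subset ?_
  rintro ξ ⟨h1, h2⟩
  by_cases hc : z.val ξ = base z.ht ξ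
  · exact Or.inr ⟨h1, hc ▸ h2⟩
  · exact Or.inl ⟨h1, hc⟩

open Classical in
/-- The restriction of a point to the coordinates below `β`. -/
noncomputable def cut (β : OmegaOne) (z : CohPoint) : OmegaOne → ℚ :=
  fun ξ => if ξ < β then z.val ξ else 0

theorem cut_eq_iff : cut β z = cut β w ↔ Agree β z w := by
  constructor
  · intro h ξ hξ
    simpa [cut, hξ] using congrFun h ξ
  · intro h
    funext ξ
    by_cases hξ : ξ < β
    · simp [cut, hξ, h ξ hξ]
    · simp [cut, hξ]

theorem countable_finite_modifications {K : Set OmegaOne} (hK : K.Countable) (g : OmegaOne → ℚ) :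
    {f : OmegaOne → ℚ | {ξ | f ξ ≠ g ξ}.Finite ∧ {ξ | f ξ ≠ g ξ} ⊆ K}.Countable := by
  classical
  have := hK.to_subtype
  refine (Set.countable_range fun u : K →₀ ℚ =>
    fun ξ => g ξ + if h : ξ ∈ K then u ⟨ξ, h⟩ else 0).mono ?_
  rintro f ⟨h1, h2⟩
  refine ⟨Finsupp.ofSupportFinite (fun ξ : K => f ξ - g ξ) ?_, ?_⟩
  · refine (h1.preimage (f := ((↑) : K → OmegaOne)) Subtype.val_injective.injOn).subset ?_
    intro ξ hξ
    simpa [sub_eq_zero] using hξ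
  · funext ξ
    by_cases hξ : ξ ∈ K
    · simp [hξ, Finsupp.ofSupportFinite_coe]
    · have : f ξ = g ξ := not_not.1 fun hc => hξ (h2 hc)
      simp [hξ, this]

/-- By coherence a restriction is a finite modification of one of countably many functions: `base h`
cut at `h` for some `h ≤ β`. -/
theorem countable_range_cut (β : OmegaOne) : (Set.range (cut β)).Countable := by
  classical
  refine ((countable_Iic β).biUnion fun h _ => countable_finite_modifications (countable_Iic h)
    (fun ξ => if ξ < h then base h ξ else 0)).mono ?_
  rintro _ ⟨z, rfl⟩
  rcases lt_or_ge z.ht β with hz | hz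
  · refine Set.mem_biUnion (x := z.ht) hz.le ?_
    have hsub : {ξ | cut β z ξ ≠ if ξ < z.ht then base z.ht ξ else 0} ⊆
        {ξ | ξ < z.ht ∧ z.val ξ ≠ base z.ht ξ} ∪ {z.ht} := by
      intro ξ hξ
      rcases lt_trichotomy ξ z.ht with h1 | h1 | h1
      · left
        simpa [cut, h1, h1.trans hz] using hξ
      · exact Or.inr h1
      · simp [cut, h1.not_gt, (z.zero_iff ξ).2 h1] at hξ
    exact ⟨(z.coh.union (Set.finite_singleton _)).subset hsub, fun ξ hξ =>
      (hsub hξ).elim (fun h => h.1.le) fun h => le_of_eq h⟩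
  · refine Set.mem_biUnion (x := β) Set.self_mem_Iic ?_
    have hsub : {ξ | cut β z ξ ≠ if ξ < β then base β ξ else 0} ⊆
        {ξ | ξ < β ∧ z.val ξ ≠ base β ξ} := by
      intro ξ hξ
      by_cases h1 : ξ < β
      · simpa [cut, h1] using hξ
      · simp [cut, h1] at hξ
    refine ⟨((z.coh.union (base_coherent z.ht β)).subset fun ξ hξ => ?_), fun ξ hξ =>
      (hsub hξ).1.le⟩
    obtain ⟨h1, h2⟩ := hsub hξ
    by_cases hc : z.val ξ = base z.ht ξ
    · exact Or.inr ⟨h1.trans_le hz, h1, hc ▸ h2⟩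
    · exact Or.inl ⟨h1.trans_le hz, hc⟩

theorem countable_ht_lt (β : OmegaOne) : {z : CohPoint | z.ht < β}.Countable := by
  refine Set.MapsTo.countable_of_injOn (f := cut β) (t := Set.range (cut β))
    (fun z _ => ⟨z, rfl⟩) ?_ (countable_range_cut β)
  intro z hz w hw h
  rw [cut_eq_iff] at h
  refine val_injective (funext fun ξ => ?_)
  rcases lt_or_ge ξ β with h1 | h1
  · exact h ξ h1
  · rw [(z.zero_iff ξ).2 (lt_of_lt_of_le hz h1), (w.zero_iff ξ).2 (lt_of_lt_of_le hw h1)]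

theorem exists_extension (z : CohPoint) {v q : ℚ} (hz : ∀ ξ < β, ξ ≤ z.ht) (hv : v ≠ 0)
    (hβ : β < h) (hq : q ≠ 0) : ∃ w : CohPoint, Agree β w z ∧ w.val β = v ∧
      (∀ ξ, β < ξ → ξ < h → w.val ξ = base h ξ) ∧ w.val h = q ∧ w.ht = h := by
  classical
  have hbase : ∀ ξ, base h ξ ≠ 0 := fun ξ => (nonInt_nat_add_half _).ne_zero
  refine ⟨⟨fun ξ => if ξ < β then z.val ξ else if ξ = β then v else if ξ < h then base h ξ else
    if ξ = h then q else 0, h, fun ξ => ?_, ?_⟩, ?_, ?_, ?_, ?_, rfl⟩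
  · rcases lt_trichotomy ξ β with h1 | h1 | h1
    · simpa [h1, (h1.trans hβ).not_gt] using val_ne_zero (hz ξ h1)
    · simpa [h1, hβ.not_gt] using hv
    · rcases lt_trichotomy ξ h with h2 | h2 | h2
      · simpa [h1.not_gt, h1.ne', h2, h2.not_gt] using hbase ξ
      · simpa [h2, hβ.not_gt, hβ.ne'] using hq
      · simp [h1.not_gt, h1.ne', h2, h2.not_gt, h2.ne']
  · refine (((z.coh.union (base_coherent z.ht h)).union (Set.finite_singleton z.ht)).union
      (Set.finite_singleton β)).subset ?_
    rintro ξ ⟨h1, h2⟩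
    rcases lt_trichotomy ξ β with h3 | h3 | h3
    · left
      simp only [h3, if_true] at h2
      rcases (hz ξ h3).lt_or_eq with h4 | h4
      · left
        by_cases hc : z.val ξ = base z.ht ξ
        · exact Or.inr ⟨h4, h1, hc ▸ h2⟩
        · exact Or.inl ⟨h4, hc⟩
      · exact Or.inr h4
    · exact Or.inr h3
    · simp [h3.not_gt, h3.ne', h1] at h2
  · intro ξ hξ
    simp [hξ]
  · simp
  · intro ξ h1 h2
    simp [h1.not_gt, h1.ne', h2]
  · simp [hβ.not_gt, hβ.ne']

end CohPoint

/-! ### The Countryman property -/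

theorem Finset.eq_of_card_filter_lt_eq {α : Type*} [LinearOrder α] {F : Finset α} {a b : α}
    (ha : a ∈ F) (hb : b ∈ F) (h : (F.filter (· < a)).card = (F.filter (· < b)).card) : a = b := by
  have key : ∀ {a b : α}, a ∈ F → a < b → (F.filter (· < a)).card < (F.filter (· < b)).card := by
    intro a b ha hab
    refine Finset.card_lt_card (Finset.ssubset_iff_of_subset ?_ |>.2 ⟨a, ?_, ?_⟩)
    · intro c hc
      rw [Finset.mem_filter] at hc ⊢
      exact ⟨hc.1, hc.2.trans hab⟩
    · simp [ha, hab]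
    · simp
  rcases lt_trichotomy a b with hab | hab | hab
  · exact absurd h (key ha hab).ne
  · exact hab
  · exact absurd h (key hb hab).ne'

namespace CohPoint

/-- The position and the values of a pair of points at the coordinates in `F`. -/
noncomputable def profile (F : Finset OmegaOne) (s t : CohPoint) : Finset (ℕ × ℚ × ℚ) :=
  F.image fun ξ => ((F.filter (· < ξ)).card, s.val ξ, t.val ξ)

/-- The finite set `F` consists of the coordinates where `s` is bounded by `n`, and `s` and `t`
differ only there. -/
structure IsCore (n : ℕ) (F : Finset OmegaOne) (s t : CohPoint) : Prop where
  ht_le : s.ht ≤ t.ht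
  mem_iff : ∀ ξ, ξ ∈ F ↔ ξ ≤ s.ht ∧ |s.val ξ| ≤ n
  eq_of_notMem : ∀ ξ ≤ s.ht, ξ ∉ F → s.val ξ = t.val ξ
  bound : ∀ ξ ∈ F, |t.val ξ| ≤ n
  ht_mem : s.ht ∈ F

/-- The bound `n` dominates both points at their finitely many differences and at the height of `s`;
the core is finite because `s` is finite-to-one. -/
theorem exists_isCore {s t : CohPoint} (h : s.ht ≤ t.ht) : ∃ n F, IsCore n F s t := by
  have hfin := (diff_finite s t).union (Set.finite_singleton s.ht)
  obtain ⟨b, hb⟩ := ((hfin.image fun ξ => |s.val ξ|).union (hfin.image fun ξ => |t.val ξ|)).bddAbove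
  obtain ⟨n, hn⟩ := exists_nat_ge b
  have h1 : ∀ ξ ∈ {ξ | ξ < s.ht ∧ ξ < t.ht ∧ s.val ξ ≠ t.val ξ} ∪ {s.ht},
      |s.val ξ| ≤ n ∧ |t.val ξ| ≤ n := fun ξ hξ =>
    ⟨(hb (Or.inl ⟨ξ, hξ, rfl⟩)).trans hn, (hb (Or.inr ⟨ξ, hξ, rfl⟩)).trans hn⟩
  have h2 : {ξ | ξ ≤ s.ht ∧ |s.val ξ| ≤ n}.Finite := by
    refine ((bounded_finite s n).union (Set.finite_singleton s.ht)).subset ?_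
    rintro ξ ⟨h3, h4⟩
    exact h3.lt_or_eq.imp (fun h => ⟨h, h4⟩) fun h => h
  have h3 : ∀ ξ ≤ s.ht, s.val ξ ≠ t.val ξ → |s.val ξ| ≤ n ∧ |t.val ξ| ≤ n := fun ξ hξ hne =>
    h1 ξ (hξ.lt_or_eq.imp (fun h' => ⟨h', h'.trans_le h, hne⟩) fun h' => h')
  refine ⟨n, h2.toFinset, h, fun ξ => by simp, fun ξ hξ hF => ?_, fun ξ hξ => ?_, ?_⟩
  · by_contra hne
    exact hF (by simpa using ⟨hξ, (h3 ξ hξ hne).1⟩)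
  · have hξ : ξ ≤ s.ht ∧ |s.val ξ| ≤ n := by simpa using hξ
    by_cases hne : s.val ξ = t.val ξ
    · exact hne ▸ hξ.2
    · exact (h3 ξ hξ.1 hne).2
  · simpa using (h1 s.ht (Or.inr rfl)).1

/-- Below the first difference `δ` of `s` and `s'` the cores coincide, since membership depends only
on the values of `s`. Hence ranks agree up to `δ`, and the profile transfers the values of `t` to
`t'` there. -/
theorem lt_of_profile_eq {n : ℕ} {F F' : Finset OmegaOne} {s t s' t' : CohPoint}
    (hF : IsCore n F s t) (hF' : IsCore n F' s' t') (hp : profile F s t = profile F' s' t')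
    (hlt : s < s') : t < t' := by
  obtain ⟨δ, hag, hδ⟩ := lt_iff.1 hlt
  have hle : ∀ (z : CohPoint) ξ, ξ ≤ z.ht ↔ z.val ξ ≠ 0 := fun z ξ => by
    rw [Ne, z.zero_iff, not_lt]
  have hmem : ∀ ξ < δ, (ξ ∈ F ↔ ξ ∈ F') := fun ξ hξ => by
    rw [hF.mem_iff, hF'.mem_iff, hle, hle, hag ξ hξ]
  have hrank : ∀ ξ ≤ δ, F.filter (· < ξ) = F'.filter (· < ξ) := by
    intro ξ hξ
    ext η
    simp only [Finset.mem_filter]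
    exact and_congr_left fun h => hmem η (h.trans_le hξ)
  have tr : ∀ ξ ∈ F, ∃ η ∈ F', (F'.filter (· < η)).card = (F.filter (· < ξ)).card ∧
      s'.val η = s.val ξ ∧ t'.val η = t.val ξ := by
    intro ξ hξ
    have h1 : ((F.filter (· < ξ)).card, s.val ξ, t.val ξ) ∈ profile F' s' t' :=
      hp ▸ Finset.mem_image_of_mem _ hξ
    simpa [profile] using h1
  have tr' : ∀ η ∈ F', ∃ ξ ∈ F, (F.filter (· < ξ)).card = (F'.filter (· < η)).card := by
    intro ξ hξ
    have h1 : ((F'.filter (· < ξ)).card, s'.val ξ, t'.val ξ) ∈ profile F s t :=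
      hp ▸ Finset.mem_image_of_mem _ hξ
    obtain ⟨η, h2, h3⟩ := Finset.mem_image.1 h1
    exact ⟨η, h2, congrArg Prod.fst h3⟩
  have tr_eq : ∀ ξ ∈ F, ξ ∈ F' → ξ ≤ δ → s'.val ξ = s.val ξ ∧ t'.val ξ = t.val ξ := by
    intro ξ h1 h2 h3
    obtain ⟨η, h4, h5, h6⟩ := tr ξ h1
    rw [hrank ξ h3] at h5
    rwa [Finset.eq_of_card_filter_lt_eq h4 h2 h5] at h6
  -- If `s` ended before `δ`, all of `F` would lie below `δ`; the last element of `F'` would have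
  -- the rank of an element of `F`, and `s'` would end before `δ` too.
  have hs : δ ≤ s.ht := by
    by_contra! hc
    have h0 := (s.zero_iff δ).2 hc
    have h1 : δ ≤ s'.ht := (hle _ _).2 (by rw [h0] at hδ; exact hδ.ne')
    obtain ⟨ξ, h2, h3⟩ := tr' _ hF'.ht_mem
    have h4 : ξ < δ := ((hF.mem_iff ξ).1 h2).1.trans_lt hc
    rw [hrank ξ h4.le] at h3
    have h5 := Finset.eq_of_card_filter_lt_eq ((hmem ξ h4).1 h2) hF'.ht_mem h3
    exact absurd h1 (h5 ▸ h4).not_ge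
  have hs' : δ ≤ s'.ht := by
    by_contra! hc
    obtain ⟨ξ, h2, h3, -⟩ := tr _ hF.ht_mem
    have h4 : ξ < δ := ((hF'.mem_iff ξ).1 h2).1.trans_lt hc
    rw [← hrank ξ h4.le] at h3
    have h5 := Finset.eq_of_card_filter_lt_eq ((hmem ξ h4).2 h2) hF.ht_mem h3
    exact absurd hs (h5 ▸ h4).not_ge
  refine lt_iff.2 ⟨δ, fun ξ hξ => ?_, ?_⟩
  · by_cases h1 : ξ ∈ F
    · exact (tr_eq ξ h1 ((hmem ξ hξ).1 h1) hξ.le).2.symm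
    · rw [← hF.eq_of_notMem ξ (hξ.le.trans hs) h1, hag ξ hξ]
      exact hF'.eq_of_notMem ξ (hξ.le.trans hs') fun h => h1 ((hmem ξ hξ).2 h)
  -- In the mixed cases one pair of values lies within `[-n, n]` and the other pair is a single
  -- common value outside, so both comparisons have the same outcome.
  · by_cases h1 : δ ∈ F <;> by_cases h2 : δ ∈ F'
    · exact absurd (tr_eq δ h1 h2 le_rfl).1 hδ.ne'
    · have h3 := abs_le.1 ((hF.mem_iff δ).1 h1).2
      have h4 := abs_le.1 (hF.bound δ h1)
      have h5 : ¬ |s'.val δ| ≤ n := fun h => h2 ((hF'.mem_iff δ).2 ⟨hs', h⟩)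
      rw [← hF'.eq_of_notMem δ hs' h2]
      rw [abs_le, not_and_or] at h5
      rcases h5 with h5 | h5 <;> linarith
    · have h3 := abs_le.1 ((hF'.mem_iff δ).1 h2).2
      have h4 := abs_le.1 (hF'.bound δ h2)
      have h5 : ¬ |s.val δ| ≤ n := fun h => h1 ((hF.mem_iff δ).2 ⟨hs, h⟩)
      rw [← hF.eq_of_notMem δ hs h1]
      rw [abs_le, not_and_or] at h5
      rcases h5 with h5 | h5 <;> linarith
    · rwa [← hF.eq_of_notMem δ hs h1, ← hF'.eq_of_notMem δ hs' h2]

end CohPoint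

/-- The square of `C` is a union of countably many chains. -/
def SquareSigmaChain (C : Type*) [LinearOrder C] : Prop :=
  ∃ S : ℕ → Set (C × C), (∀ n, IsChain (· ≤ ·) (S n)) ∧ ⋃ n, S n = Set.univ

/-- The countably many labels record which coordinate is the shorter one, the bound, and the
profile. Pairs with the same label are comparable. -/
theorem CohPoint.squareSigmaChain : SquareSigmaChain CohPoint := by
  classical
  have hlab : ∀ p : CohPoint × CohPoint, ∃ l : Bool × ℕ × Finset (ℕ × ℚ × ℚ), ∃ F,
      (l.1 = true → IsCore l.2.1 F p.1 p.2 ∧ profile F p.1 p.2 = l.2.2) ∧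
      (l.1 = false → IsCore l.2.1 F p.2 p.1 ∧ profile F p.2 p.1 = l.2.2) := by
    rintro ⟨s, t⟩
    rcases le_total s.ht t.ht with h | h
    · obtain ⟨n, F, hF⟩ := exists_isCore h
      exact ⟨(true, n, profile F s t), F, by simp [hF], by simp⟩
    · obtain ⟨n, F, hF⟩ := exists_isCore h
      exact ⟨(false, n, profile F t s), F, by simp, by simp [hF]⟩
  choose l F h1 h2 using hlab
  obtain ⟨c, hc⟩ := exists_injective_nat (Bool × ℕ × Finset (ℕ × ℚ × ℚ))
  refine ⟨fun n => {p | c (l p) = n}, fun n p hp q hq _ => ?_, by ext; simp⟩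
  have hl : l p = l q := hc (Eq.trans hp (Eq.symm hq))
  obtain ⟨s, t⟩ := p
  obtain ⟨s', t'⟩ := q
  simp only [Prod.mk_le_mk]
  cases hb : (l (s, t)).1
  · obtain ⟨h3, h4⟩ := h2 _ hb
    obtain ⟨h5, h6⟩ := h2 _ (hl ▸ hb)
    rw [← hl] at h5 h6
    rcases lt_trichotomy t t' with h | h | h
    · exact Or.inl ⟨(lt_of_profile_eq h3 h5 (h4.trans h6.symm) h).le, h.le⟩
    · rcases le_total s s' with h' | h'
      · exact Or.inl ⟨h', h.le⟩
      · exact Or.inr ⟨h', h.ge⟩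
    · exact Or.inr ⟨(lt_of_profile_eq h5 h3 (h6.trans h4.symm) h).le, h.le⟩
  · obtain ⟨h3, h4⟩ := h1 _ hb
    obtain ⟨h5, h6⟩ := h1 _ (hl ▸ hb)
    rw [← hl] at h5 h6
    rcases lt_trichotomy s s' with h | h | h
    · exact Or.inl ⟨h.le, (lt_of_profile_eq h3 h5 (h4.trans h6.symm) h).le⟩
    · rcases le_total t t' with h' | h'
      · exact Or.inl ⟨h.le, h'⟩
      · exact Or.inr ⟨h.ge, h'⟩
    · exact Or.inr ⟨h.le, (lt_of_profile_eq h5 h3 (h6.trans h4.symm) h).le⟩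

/-! ### From the Countryman property to Aronszajn lines -/

namespace SquareSigmaChain

variable {C : Type u} [LinearOrder C]

theorem subtype (h : SquareSigmaChain C) (D : Set C) : SquareSigmaChain D := by
  obtain ⟨S, h1, h2⟩ := h
  refine ⟨fun n => {p | ((p.1 : C), (p.2 : C)) ∈ S n}, fun n p hp q hq hne => ?_, ?_⟩
  · exact h1 n hp hq fun he => hne (Prod.ext (Subtype.ext (congrArg Prod.fst he))
      (Subtype.ext (congrArg Prod.snd he)))
  · ext p
    have : ((p.1 : C), (p.2 : C)) ∈ ⋃ n, S n := h2 ▸ Set.mem_univ _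
    simpa using this

theorem not_crossing {S : ℕ → Set (C × C)} (h : ∀ n, IsChain (· ≤ ·) (S n)) {n : ℕ} {a b c d : C}
    (h1 : (a, b) ∈ S n) (h2 : (c, d) ∈ S n) (hac : a < c) : b ≤ d := by
  rcases (h n).total h1 h2 with h3 | h3
  · exact h3.2
  · exact absurd h3.1 hac.not_ge

theorem exists_uncountable_section {X : Type u} {W : Type v} [Uncountable W]
    {S : ℕ → Set (X × X)} (hS : ⋃ n, S n = Set.univ) (f : W → X) (w : W) :
    ∃ n, ¬ {v | (f w, f v) ∈ S n}.Countable := by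
  by_contra! hc
  refine Set.not_countable_univ (α := W) ((Set.countable_iUnion hc).mono fun v _ => ?_)
  have : (f w, f v) ∈ ⋃ n, S n := hS ▸ Set.mem_univ _
  simpa using this

/-- Each vertical section meets some `S n` in an uncountable set. Two points share this `n`; over
the smaller one a partner can then be taken above any partner of the larger one. -/
theorem exists_pair {X : Type u} {W : Type v} [LinearOrder W] [Uncountable W]
    (hW : ∀ w : W, (Set.Iic w).Countable) {S : ℕ → Set (X × X)}
    (hS : ⋃ n, S n = Set.univ) (f : W → X) :
    ∃ n a b c d, (f a, f b) ∈ S n ∧ (f c, f d) ∈ S n ∧ a < c ∧ d < b := by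
  choose n hn using exists_uncountable_section hS f
  obtain ⟨a, c, hac, hne⟩ : ∃ a c, n a = n c ∧ a ≠ c := by
    by_contra! hc
    exact not_countable (α := W) (Function.Injective.countable (f := n) fun a b => hc a b)
  wlog hlt : a < c generalizing a c
  · exact this c a hac.symm hne.symm (lt_of_le_of_ne (not_lt.1 hlt) hne.symm)
  obtain ⟨d, hd⟩ : {v | (f c, f v) ∈ S (n c)}.Nonempty :=
    Set.nonempty_iff_ne_empty.2 fun h => hn c (h ▸ Set.countable_empty)
  obtain ⟨b, hb, hbd⟩ : ∃ b ∈ {v | (f a, f v) ∈ S (n a)}, d < b := by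
    by_contra! hc
    exact hn a ((hW d).mono fun b hb => hc b hb)
  exact ⟨n a, a, b, c, d, hb, hac ▸ hd, hlt, hbd⟩

theorem not_strictMono (h : SquareSigmaChain C) {W : Type v} [LinearOrder W] [Uncountable W]
    (hW : ∀ w : W, (Set.Iic w).Countable) (f : W → C) : ¬ StrictMono f := fun hf => by
  obtain ⟨S, h1, h2⟩ := h
  obtain ⟨n, a, b, c, d, h3, h4, h5, h6⟩ := exists_pair hW h2 f
  exact (not_crossing h1 h3 h4 (hf h5)).not_gt (hf h6)

theorem not_strictAnti (h : SquareSigmaChain C) {W : Type v} [LinearOrder W] [Uncountable W]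
    (hW : ∀ w : W, (Set.Iic w).Countable) (f : W → C) : ¬ StrictAnti f := fun hf => by
  obtain ⟨S, h1, h2⟩ := h
  obtain ⟨n, a, b, c, d, h3, h4, h5, h6⟩ := exists_pair hW h2 f
  exact (not_crossing h1 h4 h3 (hf h5)).not_gt (hf h6)

/-- If the section of `S n` over `x` has two points, a rational separates them, and the chain
condition makes this rational determine `x`. So all but countably many `x` have only sections with
at most one point, which cannot cover an uncountable set. -/
theorem countable_of_real (h : SquareSigmaChain C) (T : Set ℝ) (g : T → C) (hg : StrictMono g) :
    T.Countable := by
  obtain ⟨S, h1, h2⟩ := h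
  have hcount : ∀ n, {x : T | ∃ y z : T, y < z ∧ (g x, g y) ∈ S n ∧ (g x, g z) ∈ S n}.Countable := by
    intro n
    have hq : ∀ x : {x : T | ∃ y z : T, y < z ∧ (g x, g y) ∈ S n ∧ (g x, g z) ∈ S n},
        ∃ q : ℚ, ∃ y z : T, (y : ℝ) < q ∧ (q : ℝ) < z ∧ (g x, g y) ∈ S n ∧ (g x, g z) ∈ S n := by
      rintro ⟨x, y, z, hyz, h3, h4⟩
      obtain ⟨q, hq1, hq2⟩ := exists_rat_btwn (show (y : ℝ) < z from hyz)
      exact ⟨q, y, z, hq1, hq2, h3, h4⟩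
    choose q y z hy hz h3 h4 using hq
    refine Set.countable_coe_iff.1 (Function.Injective.countable (f := q) fun a b hab => ?_)
    have key : ∀ a b, q a = q b → ¬ (a : T) < b := fun a b hab hlt => by
      have h5 := not_crossing h1 (h4 a) (h3 b) (hg hlt)
      have h6 : z a ≤ y b := hg.le_iff_le.1 h5
      have h7 : (z a : ℝ) ≤ y b := h6
      have h8 := hy b
      rw [← hab] at h8
      linarith [hz a]
    exact Subtype.ext (le_antisymm (not_lt.1 (key b a hab.symm)) (not_lt.1 (key a b hab)))
  by_contra hT
  have hunc : Uncountable T := not_countable_iff.1 (mt Set.countable_coe_iff.1 hT)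
  obtain ⟨x, hx⟩ : ∃ x : T, ∀ n, ¬ ∃ y z : T, y < z ∧ (g x, g y) ∈ S n ∧ (g x, g z) ∈ S n := by
    by_contra! hc
    refine Set.not_countable_univ (α := T) ((Set.countable_iUnion hcount).mono fun x _ => ?_)
    simpa using hc x
  obtain ⟨n, hn⟩ := exists_uncountable_section h2 g x
  refine hn (Set.Subsingleton.countable fun y hy z hz => ?_)
  by_contra hne
  rcases lt_or_gt_of_ne hne with h' | h'
  · exact hx n ⟨y, z, h', hy, hz⟩
  · exact hx n ⟨z, y, h', hz, hy⟩

theorem isAronszajnLine (h : SquareSigmaChain C) [Uncountable C] : IsAronszajnLine C := by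
  have hunc : Uncountable (Set.Iio (ω₁ : Ordinal.{0})) :=
    (Ordinal.ToType.mk (o := ω₁)).symm.injective.uncountable
  have hW : ∀ w : Set.Iio (ω₁ : Ordinal.{0}), (Set.Iic w).Countable := fun w =>
    Set.MapsTo.countable_of_injOn (f := Ordinal.ToType.mk) (t := Set.Iic (Ordinal.ToType.mk w))
      (fun v hv => (Ordinal.ToType.mk (o := ω₁)).monotone hv) (Ordinal.ToType.mk.injective.injOn)
      (countable_Iic _)
  refine ⟨inferInstance, ?_, ?_, ?_⟩
  · rintro ⟨f⟩
    exact h.not_strictMono hW f f.strictMono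
  · rintro ⟨f⟩
    exact h.not_strictAnti hW (fun w => f (OrderDual.toDual w)) fun a b hab =>
      f.strictMono (OrderDual.toDual_lt_toDual.2 hab)
  · rintro T hT ⟨f⟩
    exact hT (h.countable_of_real T f f.strictMono)

end SquareSigmaChain

/-- A linear order without a countable cofinal subset contains a copy of `ω₁`. -/
theorem exists_strictMono_of_no_countable_cofinal {D : Type u} [LinearOrder D]
    (h : ∀ K : Set D, K.Countable → ∃ d, ∀ k ∈ K, k < d) : ∃ f : OmegaOne → D, StrictMono f := by
  classical
  have : Nonempty D := (h ∅ Set.countable_empty).nonempty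
  choose! g hg using h
  let f : OmegaOne → D := WellFoundedLT.fix fun a ih => g (Set.range fun b : Set.Iio a => ih b b.2)
  refine ⟨f, fun a b hab => ?_⟩
  have hfb : f b = g (Set.range fun c : Set.Iio b => f c) := WellFoundedLT.fix_eq _ b
  rw [hfb]
  have := (countable_Iio b).to_subtype
  exact hg _ (Set.countable_range _) _ ⟨⟨a, hab⟩, rfl⟩

/-! ### Uncountable families of finite sets of points -/

theorem exists_uncountable_fiber {I : Type u} {K : Type v} {s : Set I} (hs : ¬ s.Countable)
    (f : I → K) (hf : (f '' s).Countable) : ∃ k, ¬ {i ∈ s | f i = k}.Countable := by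
  by_contra! hc
  refine hs ((hf.biUnion fun k _ => hc k).mono fun i hi => ?_)
  exact Set.mem_iUnion₂.2 ⟨f i, Set.mem_image_of_mem f hi, hi, rfl⟩

/-- A weak Δ-system lemma. `R` has maximal size among the sets contained in uncountably many `F i`
of a fixed size, so any further coordinate occurs only countably often along with `R`. -/
theorem exists_root {I : Type u} [Uncountable I] (F : I → Finset OmegaOne) :
    ∃ (R : Finset OmegaOne) (J : Set I), ¬ J.Countable ∧
      ∀ b, {i ∈ J | ∃ ξ ∈ F i, ξ ∉ R ∧ ξ < b}.Countable := by
  classical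
  obtain ⟨n, hn⟩ := exists_uncountable_fiber (Set.not_countable_univ (α := I))
    (fun i => (F i).card) (Set.to_countable _)
  let T : Set ℕ := {k | ∃ R : Finset OmegaOne, R.card = k ∧
    ¬ {i | (F i).card = n ∧ R ⊆ F i}.Countable}
  have hT : T.Nonempty := ⟨0, ∅, rfl, by simpa using hn⟩
  have hb : BddAbove T := by
    refine ⟨n, ?_⟩
    rintro _ ⟨R, rfl, hR⟩
    obtain ⟨i, hi1, hi2⟩ : {i | (F i).card = n ∧ R ⊆ F i}.Nonempty :=
      Set.nonempty_iff_ne_empty.2 fun h => hR (h ▸ Set.countable_empty)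
    exact hi1 ▸ Finset.card_le_card hi2
  obtain ⟨R, hR, hJ⟩ := Nat.sSup_mem hT hb
  refine ⟨R, _, hJ, fun b => ?_⟩
  have h1 : ∀ ξ ∉ R, {i | ((F i).card = n ∧ R ⊆ F i) ∧ ξ ∈ F i}.Countable := by
    intro ξ hξ
    by_contra hc
    have : R.card + 1 ∈ T := by
      refine ⟨insert ξ R, Finset.card_insert_of_notMem hξ, fun h => hc (h.mono ?_)⟩
      rintro i ⟨⟨h2, h3⟩, h4⟩
      exact ⟨h2, Finset.insert_subset h4 h3⟩
    have := le_csSup hb this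
    omega
  have h2 : (Set.Iio b \ (R : Set OmegaOne)).Countable := (countable_Iio b).mono Set.sdiff_subset
  refine (h2.biUnion fun ξ hξ => h1 ξ hξ.2).mono ?_
  rintro i ⟨hi, ξ, h3, h4, h5⟩
  exact Set.mem_biUnion (x := ξ) ⟨h5, h4⟩ ⟨hi, h3⟩

namespace CohPoint

/-- The points of an uncountable family cannot cohere along unbounded initial segments. -/
theorem exists_incoherent {I : Type u} (z : I → CohPoint) (f : I → Set OmegaOne) (J : Set I)
    (hJ : ∀ b, ∃ i ∈ J, ∀ η ∈ f i, b < η) (hf : ∀ i ∈ J, (z i).ht ∈ f i) :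
    ∃ i ∈ J, ∃ j ∈ J, ∃ ξ, (∀ η ∈ f i, ξ < η) ∧ (∀ η ∈ f j, ξ < η) ∧
      (z i).val ξ ≠ (z j).val ξ := by
  by_contra! hc
  choose i hi hlt using hJ
  -- If the family cohered, the diagonal `ξ ↦ (z (i ξ)).val ξ` would agree below each `b` with the
  -- finite-to-one `z (i b)`, hence be finite-to-one on all of `ω₁`, which is absurd.
  have hfin : ∀ n : ℕ, {ξ | |(z (i ξ)).val ξ| ≤ n}.Finite := by
    intro n
    by_contra hinf
    have hinf : {ξ | |(z (i ξ)).val ξ| ≤ n}.Infinite := hinf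
    let e := hinf.natEmbedding
    obtain ⟨b, hb⟩ := exists_gt_of_countable (Set.countable_range fun k => (e k : OmegaOne))
    have h1 : (Set.range fun k => (e k : OmegaOne)).Infinite :=
      Set.infinite_range_of_injective (Subtype.val_injective.comp e.injective)
    refine h1 ((bounded_finite (z (i b)) n).subset ?_)
    rintro _ ⟨k, rfl⟩
    have h2 := hb _ ⟨k, rfl⟩
    refine ⟨h2.trans (hlt b _ (hf _ (hi b))), ?_⟩
    have h3 := hc _ (hi b) _ (hi (e k)) (e k) (fun η hη => h2.trans (hlt b η hη)) (hlt _)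
    rw [h3]
    exact (e k).2
  refine Set.not_countable_univ (α := OmegaOne)
    ((Set.countable_iUnion fun n => (hfin n).countable).mono fun ξ _ => ?_)
  obtain ⟨n, hn⟩ := exists_nat_ge |(z (i ξ)).val ξ|
  exact Set.mem_iUnion.2 ⟨n, hn⟩

/-- `F i` collects the heights of the points in `P i` and the coordinates where two of them differ.
Above the root all long points of `P i` move together for a while, so one incoherence between
representatives separates all of them in the same direction. -/
theorem exists_separated {I : Type u} [Uncountable I] (P : I → Finset CohPoint) {K : Type v}
    (tr : OmegaOne → I → K) (htr : ∀ ρ, (Set.range (tr ρ)).Countable) {Γ : Set OmegaOne}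
    (hΓ : ∀ b, ∃ γ ∈ Γ, b < γ) :
    ∃ i j, i ≠ j ∧ ∃ ρ ∈ Γ, tr ρ i = tr ρ j ∧ ∃ δ, ρ ≤ δ ∧
      ∀ z ∈ P i, ∀ w ∈ P j, ρ ≤ z.ht → ρ ≤ w.ht →
        (∀ ξ, ρ ≤ ξ → ξ < δ → z.val ξ = w.val ξ) ∧ z.val δ < w.val δ := by
  classical
  let F : I → Finset OmegaOne := fun i => (P i).image ht ∪
    (P i ×ˢ P i).biUnion fun p => (diff_finite p.1 p.2).toFinset
  have hF1 : ∀ i, ∀ z ∈ P i, z.ht ∈ F i := fun i z hz =>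
    Finset.mem_union_left _ (Finset.mem_image_of_mem _ hz)
  have hF2 : ∀ i, ∀ z ∈ P i, ∀ w ∈ P i, ∀ ξ, ξ < z.ht → ξ < w.ht → z.val ξ ≠ w.val ξ →
      ξ ∈ F i := fun i z hz w hw ξ h1 h2 h3 =>
    Finset.mem_union_right _ (Finset.mem_biUnion.2 ⟨(z, w), Finset.mk_mem_product hz hw,
      by simpa using ⟨h1, h2, h3⟩⟩)
  obtain ⟨R, J, hJ, hroot⟩ := exists_root F
  obtain ⟨r, hr⟩ := exists_gt_of_countable R.countable_toSet
  obtain ⟨ρ, hρ, hrρ⟩ := hΓ r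
  have hR : ∀ ξ, ρ ≤ ξ → ξ ∉ R := fun ξ hξ h => ((hr ξ h).trans hrρ).not_ge hξ
  obtain ⟨c, hc⟩ := exists_uncountable_fiber hJ (tr ρ) ((htr ρ).mono (Set.image_subset_range _ _))
  set J' := {i ∈ J | tr ρ i = c}
  by_cases hz : ∃ i ∈ J', ∀ z ∈ P i, z.ht < ρ
  · obtain ⟨i, hi, hz⟩ := hz
    obtain ⟨j, hj, hne⟩ : ∃ j ∈ J', i ≠ j := by
      by_contra! h
      exact hc ((Set.countable_singleton i).mono fun j hj => (h j hj).symm)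
    exact ⟨i, j, hne, ρ, hρ, hi.2.trans hj.2.symm, ρ, le_rfl, fun z h1 w _ h2 =>
      absurd (hz z h1) h2.not_gt⟩
  push Not at hz
  have : Nonempty CohPoint := by
    obtain ⟨i, hi⟩ : J'.Nonempty := Set.nonempty_iff_ne_empty.2 fun h =>
      hc (by rw [h]; exact Set.countable_empty)
    exact ⟨(hz i hi).choose⟩
  choose! z hzP hzρ using hz
  obtain ⟨k, hk⟩ := exists_uncountable_fiber hc (fun i => cut ρ (z i))
    ((countable_range_cut ρ).mono (Set.image_subset_iff.2 fun i _ => Set.mem_range_self (z i)))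
  obtain ⟨i, hi, j, hj, ξ, hξi, hξj, hne⟩ := exists_incoherent z
    (fun i => {η | η ∈ F i ∧ η ∉ R}) {i ∈ J' | cut ρ (z i) = k} (fun b => by
      by_contra! h
      refine hk ((hroot (Order.succ b)).mono fun i hi => ?_)
      obtain ⟨η, h1, h2⟩ := h i hi
      exact ⟨hi.1.1, η, h1.1, h1.2, Order.lt_succ_iff.2 h2⟩)
    (fun i hi => ⟨hF1 i _ (hzP i hi.1), hR _ (hzρ i hi.1)⟩)
  wlog hlt : z i < z j generalizing i j
  · refine this j hj i hi hξj hξi hne.symm (lt_of_le_of_ne (not_lt.1 hlt) ?_)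
    exact fun h => hne (by rw [h])
  obtain ⟨δ, hδ, hag, hδne⟩ := exists_diff_of_not_agree (β := Order.succ ξ) (z := z i) (w := z j)
    fun h => hne (h ξ (Order.lt_succ ξ))
  have hδξ := Order.lt_succ_iff.1 hδ
  have hρδ : ρ ≤ δ := by
    by_contra! h
    exact hδne (cut_eq_iff.1 (hi.2.trans hj.2.symm) δ h)
  -- Two long points of `P i` can differ above `ρ` only in `F i \ R` or beyond one of their heights,
  -- and all of this lies above `ξ ≥ δ`.
  have hclose : ∀ i ∈ J', (∀ η ∈ {η | η ∈ F i ∧ η ∉ R}, ξ < η) → ∀ w ∈ P i, ρ ≤ w.ht →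
      ∀ η, ρ ≤ η → η ≤ δ → w.val η = (z i).val η := by
    intro i hi hξ w hw hwρ η h1 h2
    by_contra h
    have h3 := hξ _ ⟨hF1 i w hw, hR _ hwρ⟩
    have h4 := hξ _ ⟨hF1 i _ (hzP i hi), hR _ (hzρ i hi)⟩
    have h5 := hξ η ⟨hF2 i w hw _ (hzP i hi) η ((h2.trans hδξ).trans_lt h3)
      ((h2.trans hδξ).trans_lt h4) h, hR η h1⟩
    exact h5.not_ge (h2.trans hδξ)
  refine ⟨i, j, fun h => hne (by rw [h]), ρ, hρ, hi.1.2.trans hj.1.2.symm, δ, hρδ,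
    fun x hx y hy hxρ hyρ => ⟨fun η h1 h2 => ?_, ?_⟩⟩
  · rw [hclose i hi.1 hξi x hx hxρ η h1 h2.le, hclose j hj.1 hξj y hy hyρ η h1 h2.le, hag η h2]
  · rw [hclose i hi.1 hξi x hx hxρ δ hρδ le_rfl, hclose j hj.1 hξj y hy hyρ δ hρδ le_rfl]
    exact (lt_iff_of_diff hag hδne).1 hlt

end CohPoint

/-! ### Martin's Axiom for finite cliques -/

/-- The conditions are the finite cliques under reverse inclusion. The hypothesis `hccc` rules out
uncountable antichains, and `hW` says that meeting `W i` is dense. -/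
theorem MartinsAxiom.exists_generic_clique (hMA : MartinsAxiom ℵ₁) {S : Type} (R : S → S → Prop)
    (hccc : ∀ 𝒜 : Set (Finset S), ¬ 𝒜.Countable → (∀ A ∈ 𝒜, ∀ a ∈ A, ∀ b ∈ A, R a b) →
      ∃ A ∈ 𝒜, ∃ B ∈ 𝒜, A ≠ B ∧ ∀ a ∈ A, ∀ b ∈ B, R a b ∧ R b a)
    {ι : Type} (hι : #ι ≤ ℵ₁) (W : ι → Set S)
    (hW : ∀ A : Finset S, (∀ a ∈ A, ∀ b ∈ A, R a b) → ∀ i, ∃ s ∈ W i, R s s ∧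
      ∀ a ∈ A, R s a ∧ R a s) :
    ∃ G : Set S, (∀ a ∈ G, ∀ b ∈ G, R a b) ∧ ∀ i, ∃ s ∈ W i, s ∈ G := by
  classical
  let P := {A : Finset S // ∀ a ∈ A, ∀ b ∈ A, R a b}
  let _ : Preorder P :=
    { le := fun A B => B.1 ⊆ A.1
      lt := fun A B => B.1 ⊆ A.1 ∧ ¬ A.1 ⊆ B.1
      lt_iff_le_not_ge := fun _ _ => Iff.rfl
      le_refl := fun A => Finset.Subset.refl _
      le_trans := fun A B C h1 h2 => h2.trans h1 }
  have : Nonempty P := ⟨⟨∅, by simp⟩⟩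
  obtain ⟨G, hG⟩ := hMA P (by
    intro T hT
    by_contra hc
    obtain ⟨_, ⟨A, hA, rfl⟩, _, ⟨B, hB, rfl⟩, hne, hAB⟩ := hccc (Subtype.val '' T)
      (fun h => hc (Set.countable_of_injective_of_countable_image Subtype.val_injective.injOn h))
      (by rintro _ ⟨A, -, rfl⟩; exact A.2)
    refine hT A hA B hB (fun h => hne (by rw [h])) ⟨⟨A.1 ∪ B.1, ?_⟩, Finset.subset_union_left,
      Finset.subset_union_right⟩
    intro a ha b hb
    rcases Finset.mem_union.1 ha with ha | ha <;> rcases Finset.mem_union.1 hb with hb | hb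
    · exact A.2 a ha b hb
    · exact (hAB a ha b hb).1
    · exact (hAB b hb a ha).2
    · exact B.2 a ha b hb)
    (Set.range fun i => {A : P | ∃ s ∈ W i, s ∈ A.1}) (Cardinal.mk_range_le.trans hι) (by
      rintro _ ⟨i, rfl⟩ A
      obtain ⟨s, hs, hss, hsA⟩ := hW A.1 A.2 i
      refine ⟨⟨insert s A.1, ?_⟩, ⟨s, hs, Finset.mem_insert_self _ _⟩, Finset.subset_insert _ _⟩
      intro a ha b hb
      rcases Finset.mem_insert.1 ha with h | h <;> rcases Finset.mem_insert.1 hb with h' | h'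
      · exact h ▸ h' ▸ hss
      · exact h ▸ (hsA b h').1
      · exact h' ▸ (hsA a h).2
      · exact A.2 a h b h')
  refine ⟨{s | ∃ A ∈ G, s ∈ A.1}, ?_, fun i => ?_⟩
  · rintro a ⟨A, hA, ha⟩ b ⟨B, hB, hb⟩
    obtain ⟨C, -, hCA, hCB⟩ := G.directed A hA B hB
    exact C.2 a (hCA ha) b (hCB hb)
  · obtain ⟨A, ⟨s, hs, hsA⟩, hA⟩ := hG _ ⟨i, rfl⟩
    exact ⟨s, hs, A, hA, hsA⟩

/-! ### Fattened sets of points -/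

/-- The values that may terminate a point. -/
def EndVal (q : ℚ) : Prop := ∃ k : ℕ, q = k + 1

theorem EndVal.not_nonInt {q : ℚ} (h : EndVal q) : ¬ NonInt q := by
  obtain ⟨k, rfl⟩ := h
  exact fun h => h (k + 1) (by push_cast; rfl)

namespace CohPoint

/-- The point `y` extends `d` by non-integral values and a terminating value. -/
structure IsOver (d y : CohPoint) : Prop where
  ht_lt : d.ht < y.ht
  agree : Agree (Order.succ d.ht) y d
  nonInt : ∀ ξ, d.ht < ξ → ξ < y.ht → NonInt (y.val ξ)
  endVal : EndVal (y.val y.ht)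

/-- No member of `D` is a proper initial segment of another one. -/
def PrefixFree (D : Set CohPoint) : Prop :=
  ∀ d ∈ D, ∀ e ∈ D, Agree (Order.succ d.ht) d e → d = e

/-- The points over the members of `D`. -/
def fatten (D : Set CohPoint) : Set CohPoint := {y | ∃ d ∈ D, IsOver d y}

/-- The colour of a point, coded by its last value. -/
noncomputable def colour (y : CohPoint) : OmegaOne := enum y.ht (⌊y.val y.ht⌋₊ - 1)

variable {D : Set CohPoint} {d e x y z w : CohPoint} {β γ δ h a : OmegaOne}

theorem colour_le (y : CohPoint) : colour y ≤ y.ht := enum_le _ _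

/-- Above `β` the half-integers of `base h` keep the values non-integral and coherent; the last
value `k + 1` with `enum h k = a` produces the colour. -/
theorem exists_over {v : ℚ} (hd : d.ht < β) (hzd : Agree (Order.succ d.ht) z d)
    (hz : ∀ ξ, d.ht < ξ → ξ < β → NonInt (z.val ξ)) (hzβ : ∀ ξ < β, ξ ≤ z.ht) (hv : NonInt v)
    (hβ : β < h) (ha : a ≤ h) :
    ∃ w, IsOver d w ∧ Agree β w z ∧ w.val β = v ∧ w.ht = h ∧ colour w = a := by
  obtain ⟨k, hk⟩ := exists_enum_eq ha
  obtain ⟨w, h1, h2, h3, h4, rfl⟩ := exists_extension (q := (k : ℚ) + 1) z hzβ hv.ne_zero hβ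
    (by positivity)
  refine ⟨w, ⟨hd.trans hβ, (h1.mono (Order.succ_le_of_lt hd)).trans hzd, fun ξ h5 h6 => ?_, k, h4⟩,
    h1, h2, rfl, ?_⟩
  · rcases lt_trichotomy ξ β with h7 | rfl | h7
    · rw [h1 ξ h7]
      exact hz ξ h5 h7
    · exact h2 ▸ hv
    · rw [h3 ξ h7 h6]
      exact nonInt_nat_add_half _
  · have : ⌊(k : ℚ) + 1⌋₊ = k + 1 := by exact_mod_cast Nat.floor_natCast (R := ℚ) (k + 1)
    rw [colour, h4, this, Nat.add_sub_cancel, hk]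

theorem exists_over_succ {v : ℚ} (hv : NonInt v) (hβ : Order.succ d.ht < h) (ha : a ≤ h) :
    ∃ w, IsOver d w ∧ w.val (Order.succ d.ht) = v ∧ w.ht = h ∧ colour w = a := by
  obtain ⟨w, h1, -, h2⟩ := exists_over (Order.lt_succ d.ht) (Agree.refl (x := d))
    (fun ξ h1 h2 => absurd h1 (Order.lt_succ_iff.1 h2).not_gt) (fun ξ h => Order.lt_succ_iff.1 h)
    hv hβ ha
  exact ⟨w, h1, h2⟩

theorem IsOver.unique (hD : PrefixFree D) (hd : d ∈ D) (he : e ∈ D) (hx : IsOver d x)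
    (hy : IsOver e y) (hxy : Agree (Order.succ d.ht) x y) : d = e := by
  rcases le_or_gt d.ht e.ht with hle | hlt
  · exact hD d hd e he (hx.agree.symm.trans (hxy.trans (hy.agree.mono (Order.succ_le_succ hle))))
  · have h1 := Order.succ_le_succ hlt.le
    exact (hD e he d hd (hy.agree.symm.trans
      ((hxy.mono h1).symm.trans (hx.agree.mono h1)))).symm

theorem PrefixFree.lt_of_lt (hD : PrefixFree D) (hd : d ∈ D) (he : e ∈ D) (hx : IsOver d x)
    (hy : IsOver e y) (hde : d < e) : x < y := by
  obtain ⟨ε, h1, h2⟩ := lt_iff.1 hde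
  have h3 : ε < Order.succ d.ht := by
    by_contra! h
    exact hde.ne (hD d hd e he (h1.mono h))
  have h4 : ε < Order.succ e.ht := by
    by_contra! h
    exact hde.ne' (hD e he d hd (h1.symm.mono h))
  refine lt_iff.2 ⟨ε, (hx.agree.mono h3.le).trans (h1.trans (hy.agree.mono h4.le).symm), ?_⟩
  rwa [hx.agree ε h3, hy.agree ε h4]

/-- An integral value above the base marks the end of a point, so no extension can run through it.
-/
theorem PrefixFree.fatten (hD : PrefixFree D) : PrefixFree (fatten D) := by
  rintro x ⟨d, hd, hx⟩ y ⟨e, he, hy⟩ hxy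
  obtain rfl := IsOver.unique hD hd he hx hy (hxy.mono (Order.succ_le_succ hx.ht_lt.le))
  refine eq_of_agree_of_ht_eq hxy ?_
  rcases lt_trichotomy x.ht y.ht with h1 | h1 | h1
  · have h2 := hy.nonInt x.ht hx.ht_lt h1
    rw [← hxy x.ht (Order.lt_succ _)] at h2
    exact absurd h2 hx.endVal.not_nonInt
  · exact h1.symm
  · have h2 := hx.nonInt y.ht hy.ht_lt h1
    rw [hxy y.ht (h1.trans (Order.lt_succ _))] at h2
    exact absurd h2 hy.endVal.not_nonInt

/-! ### Countable cofinality and closure points -/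

theorem exists_countable_cofinal (E : Set CohPoint) :
    ∃ K ⊆ E, K.Countable ∧ ∀ d ∈ E, ∃ k ∈ K, d ≤ k := by
  by_contra! hc
  obtain ⟨f, hf⟩ := exists_strictMono_of_no_countable_cofinal (D := E) fun K hK => by
    obtain ⟨d, hd, h⟩ := hc (Subtype.val '' K) (by rintro _ ⟨k, -, rfl⟩; exact k.2) (hK.image _)
    exact ⟨⟨d, hd⟩, fun k hk => h k ⟨k, hk, rfl⟩⟩
  exact (squareSigmaChain.subtype E).not_strictMono countable_Iic f hf

theorem exists_countable_coinitial (E : Set CohPoint) :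
    ∃ K ⊆ E, K.Countable ∧ ∀ d ∈ E, ∃ k ∈ K, k ≤ d := by
  by_contra! hc
  obtain ⟨f, hf⟩ := exists_strictMono_of_no_countable_cofinal (D := Eᵒᵈ) fun K hK => by
    obtain ⟨d, hd, h⟩ := hc ((fun k : Eᵒᵈ => ((OrderDual.ofDual k : E) : CohPoint)) '' K)
      (by rintro _ ⟨k, -, rfl⟩; exact (OrderDual.ofDual k).2) (hK.image _)
    exact ⟨OrderDual.toDual ⟨d, hd⟩, fun k hk => h _ ⟨k, hk, rfl⟩⟩
  exact (squareSigmaChain.subtype E).not_strictAnti countable_Iic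
    (fun a => OrderDual.ofDual (f a)) fun a b hab => hf hab

/-- Below every node of `D` at level `β`, the points of height at most `G β` are cofinal and
coinitial. -/
structure IsCofBound (D : Set CohPoint) (G : OmegaOne → OmegaOne) : Prop where
  succ_le : ∀ β, Order.succ β ≤ G β
  cofinal : ∀ β, ∀ d ∈ D, ∃ e ∈ D, Agree β e d ∧ d ≤ e ∧ e.ht ≤ G β
  coinitial : ∀ β, ∀ d ∈ D, ∃ e ∈ D, Agree β e d ∧ e ≤ d ∧ e.ht ≤ G β

/-- There are countably many nodes of level `β`, each with countable cofinality and coinitiality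
because `ω₁` and its reverse do not embed; the heights of the witnesses are therefore bounded. -/
theorem exists_isCofBound (D : Set CohPoint) : ∃ G, IsCofBound D G := by
  have key : ∀ β, ∃ b, Order.succ β ≤ b ∧ (∀ d ∈ D, ∃ e ∈ D, Agree β e d ∧ d ≤ e ∧ e.ht ≤ b) ∧
      ∀ d ∈ D, ∃ e ∈ D, Agree β e d ∧ e ≤ d ∧ e.ht ≤ b := by
    intro β
    choose K hKD hK hcof using fun c => exists_countable_cofinal {d ∈ D | cut β d = c}
    choose K' hKD' hK' hcof' using fun c => exists_countable_coinitial {d ∈ D | cut β d = c}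
    have hcount : (⋃ c ∈ Set.range (cut β), ht '' (K c ∪ K' c)).Countable :=
      (countable_range_cut β).biUnion fun c _ => ((hK c).union (hK' c)).image _
    obtain ⟨b, hb⟩ := exists_gt_of_countable (hcount.insert (Order.succ β))
    refine ⟨b, (hb _ (Set.mem_insert _ _)).le, fun d hd => ?_, fun d hd => ?_⟩
    · obtain ⟨k, hk, hle⟩ := hcof (cut β d) d ⟨hd, rfl⟩
      refine ⟨k, (hKD _ hk).1, cut_eq_iff.1 (hKD _ hk).2, hle, (hb _ (Set.mem_insert_of_mem _ ?_)).le⟩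
      exact Set.mem_iUnion₂.2 ⟨_, ⟨d, rfl⟩, k, Or.inl hk, rfl⟩
    · obtain ⟨k, hk, hle⟩ := hcof' (cut β d) d ⟨hd, rfl⟩
      refine ⟨k, (hKD' _ hk).1, cut_eq_iff.1 (hKD' _ hk).2, hle,
        (hb _ (Set.mem_insert_of_mem _ ?_)).le⟩
      exact Set.mem_iUnion₂.2 ⟨_, ⟨d, rfl⟩, k, Or.inr hk, rfl⟩
  choose G h1 h2 h3 using key
  exact ⟨G, h1, h2, h3⟩

theorem IsCofBound.mono {G H : OmegaOne → OmegaOne} (hG : IsCofBound D G) (h : ∀ β, G β ≤ H β) :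
    IsCofBound D H where
  succ_le β := (hG.succ_le β).trans (h β)
  cofinal β d hd := by
    obtain ⟨e, h1, h2, h3, h4⟩ := hG.cofinal β d hd
    exact ⟨e, h1, h2, h3, h4.trans (h β)⟩
  coinitial β d hd := by
    obtain ⟨e, h1, h2, h3, h4⟩ := hG.coinitial β d hd
    exact ⟨e, h1, h2, h3, h4.trans (h β)⟩

end CohPoint

namespace OmegaOne

/-- The points closed under `G`. -/
def closurePoints (G : OmegaOne → OmegaOne) : Set OmegaOne := {γ | ∀ β < γ, G β < γ}

theorem exists_closurePoint_gt (G : OmegaOne → OmegaOne) (b : OmegaOne) :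
    ∃ γ ∈ closurePoints G, b < γ := by
  have hH : ∀ b, ∃ c, b < c ∧ ∀ β ≤ b, G β < c := by
    intro b
    obtain ⟨c, hc⟩ := exists_gt_of_countable (((countable_Iic b).image G).insert b)
    exact ⟨c, hc _ (Set.mem_insert _ _), fun β hβ =>
      hc _ (Set.mem_insert_of_mem _ (Set.mem_image_of_mem G hβ))⟩
  choose H h1 h2 using hH
  let s : ℕ → OmegaOne := fun n => H^[n] b
  have hs : ∀ n, s (n + 1) = H (s n) := fun n => Function.iterate_succ_apply' H n b
  obtain ⟨u, hu⟩ := exists_gt_of_countable (Set.countable_range s)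
  obtain ⟨γ, hγ, hmin⟩ := WellFounded.has_min (wellFounded_lt (α := OmegaOne))
    {c | ∀ n, s n < c} ⟨u, fun n => hu _ ⟨n, rfl⟩⟩
  refine ⟨γ, fun β hβ => ?_, hγ 0⟩
  have : ∃ n, β ≤ s n := by
    by_contra! h
    exact hmin β h hβ
  obtain ⟨n, hn⟩ := this
  exact (h2 _ β hn).trans (hs n ▸ hγ (n + 1))

theorem exists_next_closurePoint (G : OmegaOne → OmegaOne) (b : OmegaOne) :
    ∃ γ ∈ closurePoints G, b < γ ∧ ∀ δ ∈ closurePoints G, b < δ → γ ≤ δ := by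
  obtain ⟨γ, ⟨h1, h2⟩, hmin⟩ := WellFounded.has_min (wellFounded_lt (α := OmegaOne))
    {c | c ∈ closurePoints G ∧ b < c} (exists_closurePoint_gt G b)
  exact ⟨γ, h1, h2, fun δ h3 h4 => not_lt.1 (hmin δ ⟨h3, h4⟩)⟩

theorem exists_last_closurePoint (G : OmegaOne → OmegaOne) (b : OmegaOne) :
    ∃ γ ∈ closurePoints G, γ ≤ b ∧ ∀ δ ∈ closurePoints G, δ ≤ b → δ ≤ γ := by
  obtain ⟨γ, hγ, hmin⟩ := WellFounded.has_min (wellFounded_lt (α := OmegaOne))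
    {c | ∀ δ ∈ closurePoints G, δ ≤ b → δ ≤ c} ⟨b, fun _ _ h => h⟩
  refine ⟨γ, fun β hβ => ?_, not_lt.1 fun h => hmin b (fun _ _ h => h) h, hγ⟩
  by_contra! hc
  refine hmin β (fun δ h1 h2 => ?_) hβ
  by_contra! h3
  exact (h1 β h3).not_ge ((hγ δ h1 h2).trans hc)

end OmegaOne

/-! ### New points of a fattened set close to given ones -/

namespace CohPoint

variable {D : Set CohPoint} {G : OmegaOne → OmegaOne} {d e l r x y z w : CohPoint}
  {β γ δ h a : OmegaOne}

theorem exists_nonInt_gt (a : ℚ) : ∃ q, NonInt q ∧ a < q :=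
  (exists_nonInt_between (lt_add_one a)).imp fun _ h => ⟨h.1, h.2.1⟩

theorem exists_nonInt_lt (a : ℚ) : ∃ q, NonInt q ∧ q < a :=
  (exists_nonInt_between (sub_one_lt a)).imp fun _ h => ⟨h.1, h.2.2⟩

theorem le_succ_ht_of_agree (hβ : β ≤ d.ht) (h : Agree β e d) : β ≤ Order.succ e.ht := by
  by_contra! hc
  exact val_ne_zero (hc.le.trans hβ) ((h _ hc).symm.trans ((e.zero_iff _).2 (Order.lt_succ _)))

/-- Splitting off before the closed level `γ` is what lets the new point avoid the node of `l` at
`γ` while its height and colour remain free. -/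
theorem exists_right (hD : PrefixFree D) (hG : IsCofBound D G) (hγ : γ ∈ closurePoints G)
    (hl : l ∈ fatten D) (hβγ : β < γ) (hβ : β ≤ l.ht) :
    ∃ b < γ, ∀ h, b < h → ∀ a ≤ h, ∃ w ∈ fatten D, Agree β w l ∧ l < w ∧ ¬ Agree γ w l ∧
      w.ht = h ∧ colour w = a := by
  obtain ⟨d, hd, hdl⟩ := hl
  rcases lt_or_ge d.ht β with hdβ | hdβ
  · refine ⟨β, hβγ, fun h hh a ha => ?_⟩
    obtain ⟨v, hv, hlt⟩ := exists_nonInt_gt (l.val β)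
    obtain ⟨w, h1, h2, h3, h4⟩ := exists_over hdβ hdl.agree
      (fun ξ h1 h2 => hdl.nonInt ξ h1 (h2.trans_le hβ)) (fun ξ h => h.le.trans hβ) hv hh ha
    exact ⟨w, ⟨d, hd, h1⟩, h2, lt_iff.2 ⟨β, h2.symm, h3 ▸ hlt⟩,
      fun hc => hlt.ne' (h3 ▸ hc β hβγ), h4⟩
  -- Here the value at `β` belongs to the base `d` and cannot be changed freely. A base `e ≥ d` in
  -- the same node is used instead, and closure of `γ` under `G` keeps it below `γ`.
  · obtain ⟨e, he, hed, hde, heG⟩ := hG.cofinal β d hd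
    have heγ : Order.succ e.ht < γ := (hG.succ_le _).trans_lt (hγ _ (heG.trans_lt (hγ β hβγ)))
    refine ⟨Order.succ e.ht, heγ, fun h hh a ha => ?_⟩
    obtain ⟨v, hv, hlt⟩ := exists_nonInt_gt (l.val (Order.succ e.ht))
    obtain ⟨w, h1, h3, h4⟩ := exists_over_succ (d := e) hv hh ha
    refine ⟨w, ⟨e, he, h1⟩, ?_, ?_, fun hc => hlt.ne' (h3 ▸ hc _ heγ), h4⟩
    · exact (h1.agree.mono (le_succ_ht_of_agree hdβ hed)).trans
        (hed.trans (hdl.agree.mono (hdβ.trans (Order.le_succ _))).symm)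
    · rcases hde.eq_or_lt with rfl | hde
      · exact lt_iff.2 ⟨_, hdl.agree.trans h1.agree.symm, h3 ▸ hlt⟩
      · exact hD.lt_of_lt hd he hdl h1 hde

theorem exists_left (hD : PrefixFree D) (hG : IsCofBound D G) (hγ : γ ∈ closurePoints G)
    (hl : l ∈ fatten D) (hβγ : β < γ) (hβ : β ≤ l.ht) :
    ∃ b < γ, ∀ h, b < h → ∀ a ≤ h, ∃ w ∈ fatten D, Agree β w l ∧ w < l ∧ ¬ Agree γ w l ∧
      w.ht = h ∧ colour w = a := by
  obtain ⟨d, hd, hdl⟩ := hl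
  rcases lt_or_ge d.ht β with hdβ | hdβ
  · refine ⟨β, hβγ, fun h hh a ha => ?_⟩
    obtain ⟨v, hv, hlt⟩ := exists_nonInt_lt (l.val β)
    obtain ⟨w, h1, h2, h3, h4⟩ := exists_over hdβ hdl.agree
      (fun ξ h1 h2 => hdl.nonInt ξ h1 (h2.trans_le hβ)) (fun ξ h => h.le.trans hβ) hv hh ha
    exact ⟨w, ⟨d, hd, h1⟩, h2, lt_iff.2 ⟨β, h2, h3 ▸ hlt⟩,
      fun hc => hlt.ne (h3 ▸ hc β hβγ), h4⟩
  · obtain ⟨e, he, hed, hde, heG⟩ := hG.coinitial β d hd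
    have heγ : Order.succ e.ht < γ := (hG.succ_le _).trans_lt (hγ _ (heG.trans_lt (hγ β hβγ)))
    refine ⟨Order.succ e.ht, heγ, fun h hh a ha => ?_⟩
    obtain ⟨v, hv, hlt⟩ := exists_nonInt_lt (l.val (Order.succ e.ht))
    obtain ⟨w, h1, h3, h4⟩ := exists_over_succ (d := e) hv hh ha
    refine ⟨w, ⟨e, he, h1⟩, ?_, ?_, fun hc => hlt.ne (h3 ▸ hc _ heγ), h4⟩
    · exact (h1.agree.mono (le_succ_ht_of_agree hdβ hed)).trans
        (hed.trans (hdl.agree.mono (hdβ.trans (Order.le_succ _))).symm)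
    · rcases hde.eq_or_lt with rfl | hde
      · exact lt_iff.2 ⟨_, h1.agree.trans hdl.agree.symm, h3 ▸ hlt⟩
      · exact hD.lt_of_lt he hd h1 hdl hde

theorem exists_middle (hD : PrefixFree D) (hG : IsCofBound D G) (hγ : γ ∈ closurePoints G)
    (hl : l ∈ fatten D) (hr : r ∈ fatten D) (hlr : l < r) (hne : ¬ Agree γ l r) :
    ∃ b < γ, ∀ h, b < h → ∀ a ≤ h, ∃ w ∈ fatten D, l < w ∧ w < r ∧ ¬ Agree γ w l ∧
      ¬ Agree γ w r ∧ w.ht = h ∧ colour w = a := by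
  obtain ⟨δ, hδγ, hag, hδ⟩ := exists_diff_of_not_agree hne
  have hlt := (lt_iff_of_diff hag hδ).1 hlr
  have hδl : δ ≤ l.ht := by
    by_contra! h
    exact hlr.ne (hD.fatten l hl r hr (hag.mono (Order.succ_le_of_lt h)))
  obtain ⟨d, hd, hdl⟩ := hl
  rcases lt_or_ge d.ht δ with hdδ | hdδ
  · refine ⟨δ, hδγ, fun h hh a ha => ?_⟩
    obtain ⟨v, hv, hlv, hvr⟩ := exists_nonInt_between hlt
    obtain ⟨w, h1, h2, h3, h4⟩ := exists_over hdδ hdl.agree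
      (fun ξ h1 h2 => hdl.nonInt ξ h1 (h2.trans_le hδl)) (fun ξ h => h.le.trans hδl) hv hh ha
    exact ⟨w, ⟨d, hd, h1⟩, lt_iff.2 ⟨δ, h2.symm, h3 ▸ hlv⟩,
      lt_iff.2 ⟨δ, h2.trans hag, h3 ▸ hvr⟩, fun hc => hlv.ne' (h3 ▸ hc δ hδγ),
      fun hc => hvr.ne (h3 ▸ hc δ hδγ), h4⟩
  -- Agreement with `l` through the coordinate `δ` already guarantees `w < r`, so it suffices to
  -- move to the right of `l` within its node of level `succ δ`.
  · obtain ⟨b, hb, hw⟩ := exists_right hD hG hγ ⟨d, hd, hdl⟩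
      ((hG.succ_le δ).trans_lt (hγ δ hδγ)) (Order.succ_le_of_lt (hdδ.trans_lt hdl.ht_lt))
    refine ⟨b, hb, fun h hh a ha => ?_⟩
    obtain ⟨w, h1, h2, h3, h4, h5⟩ := hw h hh a ha
    have h6 : w.val δ < r.val δ := h2 δ (Order.lt_succ δ) ▸ hlt
    exact ⟨w, h1, h3, lt_iff.2 ⟨δ, (h2.mono (Order.le_succ δ)).trans hag, h6⟩, h4,
      fun hc => h6.ne (hc δ hδγ), h5⟩

/-! ### The isomorphism theorem -/

/-- The assignment of `p.2` to `p.1` and `q.2` to `q.1` preserves the order, and agreement below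
the levels in `Γ`. -/
structure Match (Γ : Set OmegaOne) (p q : CohPoint × CohPoint) : Prop where
  agree : ∀ γ ∈ Γ, Agree γ p.1 q.1 ↔ Agree γ p.2 q.2
  lt : p.1 < q.1 ↔ p.2 < q.2
  gt : q.1 < p.1 ↔ q.2 < p.2

/-- Two points have the same colour, and their heights are not separated by `Γ`. -/
structure SameType (Γ : Set OmegaOne) (p : CohPoint × CohPoint) : Prop where
  colour : colour p.1 = colour p.2
  ht : ∀ γ ∈ Γ, p.1.ht < γ ↔ p.2.ht < γ

theorem agree_comm : Agree β x y ↔ Agree β y x := ⟨Agree.symm, Agree.symm⟩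

theorem Match.symm {Γ : Set OmegaOne} {p q : CohPoint × CohPoint} (h : Match Γ p q) :
    Match Γ q p :=
  ⟨fun γ hγ => by rw [agree_comm, h.agree γ hγ, agree_comm], h.gt, h.lt⟩

theorem Match.swap {Γ : Set OmegaOne} {p q : CohPoint × CohPoint} (h : Match Γ p q) :
    Match Γ p.swap q.swap :=
  ⟨fun γ hγ => (h.agree γ hγ).symm, h.lt.symm, h.gt.symm⟩

theorem SameType.swap {Γ : Set OmegaOne} {p : CohPoint × CohPoint} (h : SameType Γ p) :
    SameType Γ p.swap :=
  ⟨h.colour.symm, fun γ hγ => (h.ht γ hγ).symm⟩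

theorem Match.le {Γ : Set OmegaOne} {p q : CohPoint × CohPoint} (h : Match Γ p q)
    (hpq : p.1 ≤ q.1) : p.2 ≤ q.2 := not_lt.1 fun hc => hpq.not_gt (h.gt.2 hc)

theorem not_agree_of_le_of_lt (h1 : x ≤ l) (h2 : l < w) (h : ¬ Agree γ w l) : ¬ Agree γ w x :=
  fun hc => h (hc.trans (hc.symm.of_le_of_le h1 h2.le))

theorem not_agree_of_lt_of_le (h1 : w < r) (h2 : r ≤ x) (h : ¬ Agree γ w r) : ¬ Agree γ w x :=
  fun hc => h (hc.of_le_of_le h1.le h2)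

/-- The one-sided extension step inside the node of level `γ` that contains `x`. -/
theorem exists_between_matches (hD : PrefixFree D) (hG : IsCofBound D G) {Γ : Set OmegaOne}
    (J : Finset (CohPoint × CohPoint)) (hJ : J.Nonempty) (hJD : ∀ p ∈ J, p.2 ∈ fatten D)
    (hJJ : ∀ p ∈ J, ∀ q ∈ J, Match Γ p q) {η : OmegaOne} (hηΓ : η ∈ Γ)
    (hη : η ∈ closurePoints G) (hγη : γ < η) (hγΓ : γ ∈ Γ) (hJht : ∀ p ∈ J, γ ≤ p.2.ht)
    (hJx : ∀ p ∈ J, Agree γ x p.1) (hJx' : ∀ p ∈ J, ¬ Agree η x p.1) :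
    ∃ b < η, ∀ h, b < h → ∀ a ≤ h, ∃ w ∈ fatten D, (∀ p ∈ J, Agree γ w p.2) ∧
      (∀ p ∈ J, ¬ Agree η w p.2) ∧ (∀ p ∈ J, p.1 < x → p.2 < w) ∧ (∀ p ∈ J, x < p.1 → w < p.2) ∧
      w.ht = h ∧ colour w = a := by
  classical
  have hne : ∀ p ∈ J, p.1 < x ∨ x < p.1 := fun p hp => lt_or_gt_of_ne (by
    rintro rfl
    exact hJx' p hp Agree.refl)
  have hJag : ∀ p ∈ J, ∀ q ∈ J, Agree γ p.2 q.2 := fun p hp q hq =>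
    ((hJJ p hp q hq).agree γ hγΓ).1 ((hJx p hp).symm.trans (hJx q hq))
  have hmax : (∃ p ∈ J, p.1 < x) → ∃ l ∈ J, l.1 < x ∧ ∀ p ∈ J, p.1 < x → p.2 ≤ l.2 := by
    rintro ⟨p, hp, hpx⟩
    obtain ⟨l, hl, hmax⟩ := Finset.exists_max_image (J.filter (·.1 < x)) Prod.fst
      ⟨p, Finset.mem_filter.2 ⟨hp, hpx⟩⟩
    rw [Finset.mem_filter] at hl
    exact ⟨l, hl.1, hl.2, fun q hq hqx =>
      (hJJ q hq l hl.1).le (hmax q (Finset.mem_filter.2 ⟨hq, hqx⟩))⟩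
  have hmin : (∃ p ∈ J, x < p.1) → ∃ r ∈ J, x < r.1 ∧ ∀ p ∈ J, x < p.1 → r.2 ≤ p.2 := by
    rintro ⟨p, hp, hpx⟩
    obtain ⟨l, hl, hmax⟩ := Finset.exists_min_image (J.filter (x < ·.1)) Prod.fst
      ⟨p, Finset.mem_filter.2 ⟨hp, hpx⟩⟩
    rw [Finset.mem_filter] at hl
    exact ⟨l, hl.1, hl.2, fun q hq hqx =>
      (hJJ l hl.1 q hq).le (hmax q (Finset.mem_filter.2 ⟨hq, hqx⟩))⟩
  by_cases hL : ∃ p ∈ J, p.1 < x <;> by_cases hR : ∃ p ∈ J, x < p.1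
  · obtain ⟨l, hl, hlx, hlmax⟩ := hmax hL
    obtain ⟨r, hr, hxr, hrmin⟩ := hmin hR
    have hnag : ¬ Agree η l.2 r.2 := fun hc => hJx' l hl
      ((((hJJ l hl r hr).agree η hηΓ).2 hc).of_le_of_le hlx.le hxr.le).symm
    have hlr : l.2 < r.2 := (hJJ l hl r hr).lt.1 (hlx.trans hxr)
    obtain ⟨b, hb, hw⟩ := exists_middle hD hG hη (hJD l hl) (hJD r hr) hlr hnag
    refine ⟨b, hb, fun h hh a ha => ?_⟩
    obtain ⟨w, h1, h2, h3, h4, h5, h6⟩ := hw h hh a ha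
    refine ⟨w, h1, fun p hp => ?_, fun p hp => ?_, fun p hp hpx => (hlmax p hp hpx).trans_lt h2,
      fun p hp hpx => h3.trans_le (hrmin p hp hpx), h6⟩
    · exact ((hJag l hl r hr).of_le_of_le h2.le h3.le).symm.trans (hJag l hl p hp)
    · rcases hne p hp with hpx | hpx
      · exact not_agree_of_le_of_lt (hlmax p hp hpx) h2 h4
      · exact not_agree_of_lt_of_le h3 (hrmin p hp hpx) h5
  · obtain ⟨l, hl, hlx, hlmax⟩ := hmax hL
    push Not at hR
    obtain ⟨b, hb, hw⟩ := exists_right hD hG hη (hJD l hl) hγη (hJht l hl)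
    refine ⟨b, hb, fun h hh a ha => ?_⟩
    obtain ⟨w, h1, h2, h3, h4, h6⟩ := hw h hh a ha
    refine ⟨w, h1, fun p hp => h2.trans (hJag l hl p hp), fun p hp => ?_,
      fun p hp hpx => (hlmax p hp hpx).trans_lt h3, fun p hp hpx => absurd hpx (hR p hp).not_gt, h6⟩
    exact not_agree_of_le_of_lt (hlmax p hp ((hne p hp).resolve_right (hR p hp).not_gt)) h3 h4
  · obtain ⟨r, hr, hxr, hrmin⟩ := hmin hR
    push Not at hL
    obtain ⟨b, hb, hw⟩ := exists_left hD hG hη (hJD r hr) hγη (hJht r hr)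
    refine ⟨b, hb, fun h hh a ha => ?_⟩
    obtain ⟨w, h1, h2, h3, h4, h6⟩ := hw h hh a ha
    refine ⟨w, h1, fun p hp => h2.trans (hJag r hr p hp), fun p hp => ?_,
      fun p hp hpx => absurd hpx (hL p hp).not_gt, fun p hp hpx => h3.trans_le (hrmin p hp hpx), h6⟩
    exact not_agree_of_lt_of_le h3 (hrmin p hp ((hne p hp).resolve_left (hL p hp).not_gt)) h4
  · obtain ⟨p, hp⟩ := hJ
    exact ((hne p hp).elim (fun h => hL ⟨p, hp, h⟩) fun h => hR ⟨p, hp, h⟩).elim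

/-- Raising the height of `x` above `b` crosses no closure point: any closure point above `x.ht` is
at least `η`, hence above `succ b`. -/
theorem exists_sameType {γ η b : OmegaOne} (hγx : γ ≤ x.ht)
    (hnext : ∀ δ ∈ closurePoints G, γ < δ → η ≤ δ) (hη : ∀ β < η, Order.succ β < η) (hb : b < η) :
    ∃ h, b < h ∧ colour x ≤ h ∧ ∀ δ ∈ closurePoints G, x.ht < δ ↔ h < δ := by
  refine ⟨max x.ht (Order.succ b), lt_max_of_lt_right (Order.lt_succ b),
    (colour_le x).trans (le_max_left _ _), fun δ hδ => ⟨fun h => ?_, fun h => ?_⟩⟩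
  · exact max_lt h ((hη b hb).trans_le (hnext δ hδ (hγx.trans_lt h)))
  · exact (le_max_left _ _).trans_lt h

theorem exists_last_agree (hxy : x ≠ y) : ∃ γ ∈ closurePoints G, Agree γ x y ∧
    ∀ δ ∈ closurePoints G, Agree δ x y → δ ≤ γ := by
  obtain ⟨δ, h1, h2⟩ := exists_diff hxy
  obtain ⟨γ, h3, h4, h5⟩ := exists_last_closurePoint G δ
  exact ⟨γ, h3, h1.mono h4, fun ε h6 h7 => h5 ε h6 (not_lt.1 fun h => h2 (h7 δ h))⟩

theorem exists_match (hD : PrefixFree D) (hG : IsCofBound D G) (hne : D.Nonempty)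
    (A : Finset (CohPoint × CohPoint)) (hAD : ∀ p ∈ A, p.2 ∈ fatten D)
    (hAt : ∀ p ∈ A, SameType (closurePoints G) p)
    (hAA : ∀ p ∈ A, ∀ q ∈ A, Match (closurePoints G) p q) (x : CohPoint) :
    ∃ y ∈ fatten D, SameType (closurePoints G) (x, y) ∧
      ∀ p ∈ A, Match (closurePoints G) (x, y) p := by
  classical
  by_cases hxA : ∃ p ∈ A, p.1 = x
  · obtain ⟨p, hp, rfl⟩ := hxA
    exact ⟨p.2, hAD p hp, hAt p hp, fun q hq => hAA p hp q hq⟩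
  push Not at hxA
  have hclosed : ∀ γ ∈ closurePoints G, ∀ β < γ, Order.succ β < γ := fun γ hγ β hβ =>
    (hG.succ_le β).trans_lt (hγ β hβ)
  rcases A.eq_empty_or_nonempty with rfl | hA
  · obtain ⟨η, hη, hlt, hnext⟩ := exists_next_closurePoint G ⊥
    obtain ⟨d, hd⟩ := hne
    obtain ⟨l, hl, -⟩ := exists_over_succ (d := d) (nonInt_nat_add_half 0) (Order.lt_succ _)
      (le_refl (Order.succ (Order.succ d.ht)))
    obtain ⟨b, hb, hw⟩ := exists_right hD hG hη ⟨d, hd, hl⟩ hlt bot_le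
    obtain ⟨h, h1, h2, h3⟩ := exists_sameType bot_le hnext (hclosed η hη) hb (x := x)
    obtain ⟨w, hw1, -, -, -, rfl, hw2⟩ := hw h h1 _ h2
    exact ⟨w, hw1, ⟨hw2.symm, h3⟩, by simp⟩
  choose! g hgΓ hgx hgmax using fun p (hp : p ∈ A) =>
    exists_last_agree (G := G) (fun h => hxA p hp h.symm : x ≠ p.1)
  obtain ⟨i, hi, himax⟩ := Finset.exists_max_image A g hA
  have hγ := hgΓ i hi
  -- The last level of the club at which `x` still shares a node with a first coordinate from `A`.
  -- The new point is separated from its companions between `γ` and the next level `η`.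
  set γ := g i
  obtain ⟨η, hη, hγη, hnext⟩ := exists_next_closurePoint G γ
  have hxη : ∀ p ∈ A, ¬ Agree η x p.1 := fun p hp hc =>
    ((hgmax p hp η hη hc).trans (himax p hp)).not_gt hγη
  have hht : ∀ p ∈ A, Agree γ x p.1 → γ ≤ x.ht ∧ γ ≤ p.2.ht := by
    intro p hp hag
    constructor
    · by_contra! hc
      exact hxA p hp (eq_of_agree hag (hclosed γ hγ _ hc)).symm
    · rw [← not_lt, ← (hAt p hp).ht γ hγ]
      intro hc
      exact hxA p hp (eq_of_agree hag.symm (hclosed γ hγ _ hc))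
  have hJ : ∀ p ∈ A.filter (fun p => Agree γ x p.1), p ∈ A ∧ Agree γ x p.1 := fun p hp =>
    Finset.mem_filter.1 hp
  have hiJ : i ∈ A.filter (fun p => Agree γ x p.1) := Finset.mem_filter.2 ⟨hi, hgx i hi⟩
  obtain ⟨b, hb, hw⟩ := exists_between_matches hD hG (x := x) (A.filter fun p => Agree γ x p.1)
    ⟨i, hiJ⟩ (fun p hp => hAD p (hJ p hp).1)
    (fun p hp q hq => hAA p (hJ p hp).1 q (hJ q hq).1) hη hη hγη hγ
    (fun p hp => (hht p (hJ p hp).1 (hJ p hp).2).2) (fun p hp => (hJ p hp).2)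
    (fun p hp => hxη p (hJ p hp).1)
  obtain ⟨h, h1, h2, h3⟩ := exists_sameType (hht i hi (hgx i hi)).1 hnext (hclosed η hη) hb
  obtain ⟨y, hy, hag, hnag, hlt, hgt, rfl, hcol⟩ := hw h h1 _ h2
  refine ⟨y, hy, ⟨hcol.symm, h3⟩, fun p hp => ?_⟩
  by_cases hpx : Agree γ x p.1
  · have hpJ : p ∈ A.filter (fun p => Agree γ x p.1) := Finset.mem_filter.2 ⟨hp, hpx⟩
    have h4 : x < p.1 ↔ y < p.2 := by
      refine ⟨hgt p hpJ, fun h => ?_⟩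
      by_contra hc
      exact h.not_gt (hlt p hpJ (lt_of_le_of_ne (not_lt.1 hc) (hxA p hp)))
    have h5 : p.1 < x ↔ p.2 < y := by
      refine ⟨hlt p hpJ, fun h => ?_⟩
      by_contra hc
      exact h.not_gt (hgt p hpJ (lt_of_le_of_ne (not_lt.1 hc) (hxA p hp).symm))
    refine ⟨fun δ hδ => ?_, h4, h5⟩
    rcases le_or_gt δ γ with h6 | h6
    · exact iff_of_true (hpx.mono h6) ((hag p hpJ).mono h6)
    · have h7 := hnext δ hδ h6
      exact iff_of_false (fun hc => hxη p hp (hc.mono h7)) fun hc => hnag p hpJ (hc.mono h7)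
  -- Such a `p.1` lies outside the node of level `γ` that contains `x` and `i.1`, so `x` is related
  -- to it exactly as `i.1` is.
  · have hxi := hgx i hi
    have hyi := hag i hiJ
    have hm := hAA i hi p hp
    have hi1 : ¬ Agree γ p.1 i.1 := fun hc => hpx (hxi.trans hc.symm)
    have hi2 : ¬ Agree γ p.2 i.2 := fun hc => hi1 ((hm.agree γ hγ).2 hc.symm).symm
    refine ⟨fun δ hδ => ?_, ?_, ?_⟩
    · rcases le_or_gt δ γ with h6 | h6
      · refine ⟨fun hc => ?_, fun hc => ?_⟩
        · exact (hyi.mono h6).trans ((hm.agree δ hδ).1 ((hxi.mono h6).symm.trans hc))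
        · exact (hxi.mono h6).trans ((hm.agree δ hδ).2 ((hyi.mono h6).symm.trans hc))
      · exact iff_of_false (fun hc => hpx (hc.mono h6.le)) fun hc =>
          hi2 ((hc.mono h6.le).symm.trans hyi)
    · rw [← lt_congr_left hi1 hxi.symm, ← lt_congr_left hi2 hyi.symm]
      exact hm.lt
    · rw [← lt_congr_right hi1 hxi.symm, ← lt_congr_right hi2 hyi.symm]
      exact hm.gt

end CohPoint

theorem Set.Countable.countable_finset_subset {α : Type u} {s : Set α} (hs : s.Countable) :
    {t : Finset α | (t : Set α) ⊆ s}.Countable := by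
  refine Set.MapsTo.countable_of_injOn (f := fun t : Finset α => (t : Set α))
    (t := {t | t.Finite ∧ t ⊆ s}) (fun t ht => ⟨t.finite_toSet, ht⟩)
    Finset.coe_injective.injOn (Set.countable_ofPred_finite_subset hs)

/-! ### The chain condition and the generic isomorphism -/

namespace CohPoint

theorem mk_le : #CohPoint ≤ ℵ₁ := by
  choose c hc using fun h : OmegaOne => (countable_ht_lt h).to_subtype.exists_injective_nat
  have hinj : Function.Injective fun z : CohPoint =>
      (z.ht, c (Order.succ z.ht) ⟨z, Order.lt_succ z.ht⟩) := by
    intro z w hzw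
    simp only [Prod.mk.injEq] at hzw
    obtain ⟨h1, h2⟩ := hzw
    have key : ∀ h k (hz : z.ht < h) (hw : w.ht < k), h = k → c h ⟨z, hz⟩ = c k ⟨w, hw⟩ → z = w := by
      rintro h _ hz hw rfl he
      exact congrArg Subtype.val (hc h he)
    exact key _ _ _ _ (by rw [h1]) h2
  refine (Cardinal.mk_le_of_injective hinj).trans ?_
  rw [Cardinal.mk_prod, OmegaOne.mk_eq]
  simp

variable {D E : Set CohPoint} {G : OmegaOne → OmegaOne}

theorem Match.refl {Γ : Set OmegaOne} (p : CohPoint × CohPoint) : Match Γ p p :=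
  ⟨fun _ _ => iff_of_true Agree.refl Agree.refl, iff_of_false (lt_irrefl _) (lt_irrefl _),
    iff_of_false (lt_irrefl _) (lt_irrefl _)⟩

theorem Match.of_agree {Γ : Set OmegaOne} {p q r : CohPoint × CohPoint} {ρ : OmegaOne} (hρ : ρ ∈ Γ)
    (h : Match Γ p q) (hne : ¬ Agree ρ p.1 q.1) (h1 : Agree ρ q.1 r.1) (h2 : Agree ρ q.2 r.2) :
    Match Γ p r := by
  have hne' := mt (h.agree ρ hρ).2 hne
  refine ⟨fun δ hδ => ?_, ?_, ?_⟩
  · rcases le_or_gt δ ρ with hle | hlt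
    · have h3 := h.agree δ hδ
      exact ⟨fun h4 => (h3.1 (h4.trans (h1.mono hle).symm)).trans (h2.mono hle),
        fun h4 => (h3.2 (h4.trans (h2.mono hle).symm)).trans (h1.mono hle)⟩
    · exact iff_of_false (fun h4 => hne ((h4.mono hlt.le).trans h1.symm))
        fun h4 => hne' ((h4.mono hlt.le).trans h2.symm)
  · rw [← lt_congr_right hne h1, ← lt_congr_right hne' h2]
    exact h.lt
  · rw [← lt_congr_left hne h1, ← lt_congr_left hne' h2]
    exact h.gt

theorem Match.of_diff {Γ : Set OmegaOne} {p q : CohPoint × CohPoint} {δ : OmegaOne}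
    (h1 : Agree δ p.1 q.1) (h2 : Agree δ p.2 q.2) (h3 : p.1.val δ < q.1.val δ)
    (h4 : p.2.val δ < q.2.val δ) : Match Γ p q := by
  have h5 : p.1 < q.1 := lt_iff.2 ⟨δ, h1, h3⟩
  have h6 : p.2 < q.2 := lt_iff.2 ⟨δ, h2, h4⟩
  refine ⟨fun ε _ => ?_, iff_of_true h5 h6, iff_of_false h5.not_gt h6.not_gt⟩
  rcases le_or_gt ε δ with hle | hlt
  · exact iff_of_true (h1.mono hle) (h2.mono hle)
  · exact iff_of_false (fun h => h3.ne (h δ hlt)) fun h => h4.ne (h δ hlt)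

/-- The trace of a condition at `ρ` consists of the restrictions of its pairs. Two conditions with
equal traces and separated upper parts are compatible: nodes that split below `ρ` are controlled by
a pair `r` with the trace of `q`, the rest by the common first difference `δ`. -/
theorem exists_match_union (hG : ∀ β, Order.succ β ≤ G β)
    (𝒜 : Set (Finset (CohPoint × CohPoint))) (h𝒜 : ¬ 𝒜.Countable)
    (ht : ∀ A ∈ 𝒜, ∀ p ∈ A, SameType (closurePoints G) p)
    (hm : ∀ A ∈ 𝒜, ∀ p ∈ A, ∀ q ∈ A, Match (closurePoints G) p q) :
    ∃ A ∈ 𝒜, ∃ B ∈ 𝒜, A ≠ B ∧ ∀ p ∈ A, ∀ q ∈ B, Match (closurePoints G) p q := by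
  classical
  have : Uncountable 𝒜 := not_countable_iff.1 (mt Set.countable_coe_iff.1 h𝒜)
  obtain ⟨A, B, hAB, ρ, hρ, htr, δ, hρδ, hsep⟩ := exists_separated (I := 𝒜)
    (fun A => A.1.image Prod.fst ∪ A.1.image Prod.snd)
    (fun ρ A => A.1.image fun p => (cut ρ p.1, cut ρ p.2))
    (fun ρ => (((countable_range_cut ρ).prod (countable_range_cut ρ)).countable_finset_subset).mono
      (by
        rintro _ ⟨A, rfl⟩ _ hp
        obtain ⟨p, -, rfl⟩ := Finset.mem_image.1 (Finset.mem_coe.1 hp)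
        exact ⟨⟨_, rfl⟩, ⟨_, rfl⟩⟩))
    (exists_closurePoint_gt G)
  have hclosed : ∀ β < ρ, Order.succ β < ρ := fun β hβ => (hG β).trans_lt (hρ β hβ)
  refine ⟨A, A.2, B, B.2, fun h => hAB (Subtype.ext h), fun p hp q hq => ?_⟩
  obtain ⟨r, hr, hrq⟩ : ∃ r ∈ A.1, (cut ρ r.1, cut ρ r.2) = (cut ρ q.1, cut ρ q.2) := by
    have : (cut ρ q.1, cut ρ q.2) ∈ A.1.image fun p => (cut ρ p.1, cut ρ p.2) := by
      rw [htr]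
      exact Finset.mem_image_of_mem (fun p : CohPoint × CohPoint => (cut ρ p.1, cut ρ p.2)) hq
    exact Finset.mem_image.1 this
  obtain ⟨h1, h2⟩ := Prod.mk.inj hrq
  rw [cut_eq_iff] at h1 h2
  have hpr := hm A A.2 p hp r hr
  by_cases hag : Agree ρ p.1 r.1
  swap
  · exact hpr.of_agree hρ hag h1 h2
  have h3 := hag.trans h1
  have h4 := ((hpr.agree ρ hρ).1 hag).trans h2
  -- Since `ρ` does not separate the heights within a pair, either both coordinates end below `ρ`
  -- and agreement forces `p = q`, or both reach `ρ` and the separation applies to both.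
  have htp := (ht A A.2 p hp).ht ρ hρ
  have htq := (ht B B.2 q hq).ht ρ hρ
  by_cases hp1 : p.1.ht < ρ
  · have h5 := eq_of_agree h3 (hclosed _ hp1)
    have h6 := eq_of_agree h4 (hclosed _ (htp.1 hp1))
    rw [Prod.ext h5 h6]
    exact Match.refl q
  by_cases hq1 : q.1.ht < ρ
  · have h5 := eq_of_agree h3.symm (hclosed _ hq1)
    exact absurd (h5 ▸ hq1) hp1
  have h5 := hsep p.1 (by simpa using Or.inl ⟨_, hp⟩) q.1 (by simpa using Or.inl ⟨_, hq⟩)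
    (not_lt.1 hp1) (not_lt.1 hq1)
  have h6 := hsep p.2 (by simpa using Or.inr ⟨_, hp⟩) q.2 (by simpa using Or.inr ⟨_, hq⟩)
    (not_lt.1 (mt htp.2 hp1)) (not_lt.1 (mt htq.2 hq1))
  refine Match.of_diff (δ := δ) (fun ξ hξ => ?_) (fun ξ hξ => ?_) h5.2 h6.2
  · exact (lt_or_ge ξ ρ).elim (h3 ξ) fun h => h5.1 ξ h hξ
  · exact (lt_or_ge ξ ρ).elim (h4 ξ) fun h => h6.1 ξ h hξ

/-- Under Martin's Axiom, any two fattened sets are isomorphic, with preservation of colours. -/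
theorem exists_colour_iso (hMA : MartinsAxiom ℵ₁) (hD : PrefixFree D) (hE : PrefixFree E)
    (hDne : D.Nonempty) (hEne : E.Nonempty) :
    ∃ f : fatten D ≃o fatten E, ∀ x, colour (f x) = colour (x : CohPoint) := by
  classical
  obtain ⟨G₁, hG₁⟩ := exists_isCofBound D
  obtain ⟨G₂, hG₂⟩ := exists_isCofBound E
  -- A common bound gives one club that serves extensions in both directions.
  let G := fun β => max (G₁ β) (G₂ β)
  have hGD : IsCofBound D G := hG₁.mono fun β => le_max_left _ _
  have hGE : IsCofBound E G := hG₂.mono fun β => le_max_right _ _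
  let S := {p : CohPoint × CohPoint // (p.1 ∈ fatten D ∧ p.2 ∈ fatten E) ∧
    SameType (closurePoints G) p}
  obtain ⟨T, hT, hTW⟩ := hMA.exists_generic_clique (S := S)
    (fun p q => Match (closurePoints G) p.1 q.1)
    (by
      intro 𝒜 h𝒜 hgood
      obtain ⟨_, ⟨A, hA, rfl⟩, _, ⟨B, hB, rfl⟩, hne, hAB⟩ := exists_match_union hGD.succ_le
        ((fun A : Finset S => A.image Subtype.val) '' 𝒜)
        (fun h => h𝒜 (Set.countable_of_injective_of_countable_image
          (Finset.image_injective Subtype.val_injective).injOn h))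
        (by
          rintro _ ⟨A, hA, rfl⟩ p hp
          obtain ⟨s, -, rfl⟩ := Finset.mem_image.1 hp
          exact s.2.2)
        (by
          rintro _ ⟨A, hA, rfl⟩ p hp q hq
          obtain ⟨s, hs, rfl⟩ := Finset.mem_image.1 hp
          obtain ⟨t, ht, rfl⟩ := Finset.mem_image.1 hq
          exact hgood A hA s hs t ht)
      refine ⟨A, hA, B, hB, fun h => hne (by rw [h]), fun a ha b hb => ?_⟩
      have := hAB _ (Finset.mem_image_of_mem _ ha) _ (Finset.mem_image_of_mem _ hb)
      exact ⟨this, this.symm⟩)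
    (ι := fatten D ⊕ fatten E)
    (by
      rw [Cardinal.mk_sum, Cardinal.lift_id, Cardinal.lift_id]
      exact Cardinal.add_le_of_le (Cardinal.aleph0_le_aleph 1) ((Cardinal.mk_set_le _).trans mk_le)
        ((Cardinal.mk_set_le _).trans mk_le))
    (Sum.elim (fun x => {s | s.1.1 = x}) fun y => {s | s.1.2 = y})
    (by
      intro A hA i
      rcases i with ⟨x, hx⟩ | ⟨y, hy⟩
      · obtain ⟨y, hy, hxy, hm⟩ := exists_match hE hGE hEne (A.image Subtype.val)
          (by
            intro p hp
            obtain ⟨s, hs, rfl⟩ := Finset.mem_image.1 hp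
            exact s.2.1.2)
          (by
            intro p hp
            obtain ⟨s, hs, rfl⟩ := Finset.mem_image.1 hp
            exact s.2.2)
          (by
            intro p hp q hq
            obtain ⟨s, hs, rfl⟩ := Finset.mem_image.1 hp
            obtain ⟨t, ht, rfl⟩ := Finset.mem_image.1 hq
            exact hA s hs t ht) x
        refine ⟨⟨(x, y), ⟨hx, hy⟩, hxy⟩, rfl, Match.refl _, fun a ha => ?_⟩
        have := hm _ (Finset.mem_image_of_mem _ ha)
        exact ⟨this, this.symm⟩
      · obtain ⟨x, hx, hxy, hm⟩ := exists_match hD hGD hDne (A.image fun s => s.1.swap)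
          (by
            intro p hp
            obtain ⟨s, hs, rfl⟩ := Finset.mem_image.1 hp
            exact s.2.1.1)
          (by
            intro p hp
            obtain ⟨s, hs, rfl⟩ := Finset.mem_image.1 hp
            exact s.2.2.swap)
          (by
            intro p hp q hq
            obtain ⟨s, hs, rfl⟩ := Finset.mem_image.1 hp
            obtain ⟨t, ht, rfl⟩ := Finset.mem_image.1 hq
            exact (hA s hs t ht).swap) y
        refine ⟨⟨(x, y), ⟨hx, hy⟩, hxy.swap⟩, rfl, Match.refl _, fun a ha => ?_⟩
        have := (hm _ (Finset.mem_image_of_mem (fun s : S => s.1.swap) ha)).swap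
        exact ⟨this, this.symm⟩)
  choose s hsW hsT using fun x : fatten D => hTW (Sum.inl x)
  have hmono : StrictMono fun x => (⟨(s x).1.2, (s x).2.1.2⟩ : fatten E) := by
    intro x y hxy
    refine (hT _ (hsT x) _ (hsT y)).lt.1 ?_
    have h1 : (s x).1.1 = x := hsW x
    have h2 : (s y).1.1 = y := hsW y
    rw [h1, h2]
    exact hxy
  refine ⟨StrictMono.orderIsoOfSurjective _ hmono fun y => ?_, fun x => ?_⟩
  · obtain ⟨t, ht, htT⟩ := hTW (Sum.inr y)
    have ht : t.1.2 = y := ht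
    refine ⟨⟨t.1.1, t.2.1.1⟩, Subtype.ext ?_⟩
    have h1 : (s ⟨t.1.1, t.2.1.1⟩).1.1 = t.1.1 := hsW _
    have h2 := hT _ (hsT ⟨t.1.1, t.2.1.1⟩) _ htT
    exact (le_antisymm (h2.le h1.le) (h2.symm.le h1.ge)).trans ht
  · have h1 : (s x).1.1 = x := hsW x
    have h2 := (s x).2.2.colour
    rw [h1] at h2
    exact h2.symm

end CohPoint

/-! ### Suborders of strongly surjective orders -/

theorem StronglySurjective.dual {A : Type u} [LinearOrder A] (h : StronglySurjective A) :
    StronglySurjective Aᵒᵈ := by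
  rintro B _ ⟨g⟩
  rcases h Bᵒᵈ ⟨g.dual.trans (OrderIso.dualDual A).symm.toOrderEmbedding⟩ with h | ⟨f, hf, hs⟩
  · exact Or.inl ⟨fun b => h.false (OrderDual.toDual b)⟩
  · exact Or.inr ⟨fun a => OrderDual.ofDual (f (OrderDual.ofDual a)), fun a b hab => hf hab,
      fun b => (hs (OrderDual.toDual b)).imp fun a ha => congrArg OrderDual.ofDual ha⟩

/-- Otherwise `A` would map onto both `ω₁` and `ω`. Preimages of the natural numbers would be
cofinal in `A`, and their images a countable cofinal subset of `ω₁`. -/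
theorem StronglySurjective.not_strictMono {A : Type u} [LinearOrder A] (h : StronglySurjective A)
    (g : OmegaOne → A) : ¬ StrictMono g := fun hg => by
  have hne : ¬ IsEmpty (ULift.{u} OmegaOne) := fun h => h.false ⟨⊥⟩
  have hne' : ¬ IsEmpty (ULift.{u} ℕ) := fun h => h.false ⟨0⟩
  obtain ⟨s, hs⟩ := Nat.exists_strictMono OmegaOne
  obtain ⟨f, hf, hfs⟩ := (h (ULift.{u} OmegaOne)
    ⟨OrderEmbedding.ofStrictMono (fun a => g a.down) fun a b hab => hg hab⟩).resolve_left hne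
  obtain ⟨k, hk, hks⟩ := (h (ULift.{u} ℕ)
    ⟨OrderEmbedding.ofStrictMono (fun a => g (s a.down)) fun a b hab => hg (hs hab)⟩).resolve_left
      hne'
  choose a ha using fun n : ℕ => hks ⟨n⟩
  obtain ⟨b, hb⟩ := exists_gt_of_countable (Set.countable_range fun n => (f (a n)).down)
  obtain ⟨x, hx⟩ := hfs ⟨b⟩
  have h1 : x ≤ a ((k x).down + 1) := by
    by_contra! hc
    have h2 := hk hc.le
    rw [ha] at h2
    have h3 : (k x).down + 1 ≤ (k x).down := h2
    omega
  have h2 := hf h1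
  rw [hx] at h2
  exact (hb _ ⟨_, rfl⟩).not_ge h2

theorem StronglySurjective.exists_countable_cofinal {A B : Type u} [LinearOrder A] [LinearOrder B]
    (h : StronglySurjective A) (g : B ↪o A) : ∃ K : Set B, K.Countable ∧ ∀ b, ∃ k ∈ K, b ≤ k := by
  by_contra! hc
  obtain ⟨f, hf⟩ := exists_strictMono_of_no_countable_cofinal hc
  exact h.not_strictMono _ (g.strictMono.comp hf)

theorem exists_monotone_cofinal {B : Type u} [LinearOrder B] (b₀ : B) {K : Set B}
    (hK : K.Countable) (hcof : ∀ b, ∃ k ∈ K, b ≤ k) :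
    ∃ s : ℕ → B, s 0 = b₀ ∧ Monotone s ∧ ∀ b, ∃ n, b ≤ s n := by
  obtain ⟨t, ht⟩ := hK.exists_eq_range ⟨_, (hcof b₀).choose_spec.1⟩
  let t' : ℕ → B := fun n => n.casesOn b₀ t
  refine ⟨partialSups t', by simp [t'], (partialSups t').monotone, fun b => ?_⟩
  obtain ⟨k, hk, hb⟩ := hcof b
  rw [ht] at hk
  obtain ⟨n, rfl⟩ := hk
  exact ⟨n + 1, hb.trans (le_partialSups t' (n + 1))⟩

/-- The sequence is only weakly monotone, which admits orders with endpoints. -/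
theorem StronglySurjective.exists_int_seq {A B : Type u} [LinearOrder A] [LinearOrder B]
    [Nonempty B] (h : StronglySurjective A) (g : B ↪o A) :
    ∃ b : ℤ → B, Monotone b ∧ (∀ x, ∃ n, x ≤ b n) ∧ ∀ x, ∃ n, b n ≤ x := by
  obtain ⟨b₀⟩ := ‹Nonempty B›
  obtain ⟨K, hK, hcof⟩ := h.exists_countable_cofinal g
  obtain ⟨s, hs0, hs, hsc⟩ := exists_monotone_cofinal b₀ hK hcof
  obtain ⟨K', hK', hcof'⟩ := h.dual.exists_countable_cofinal g.dual
  obtain ⟨t, ht0, ht, htc⟩ := exists_monotone_cofinal (OrderDual.toDual b₀) hK' hcof'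
  refine ⟨fun n => if 0 ≤ n then s n.toNat else OrderDual.ofDual (t (-n).toNat), ?_, fun x => ?_,
    fun x => ?_⟩
  · have hs' : ∀ n, b₀ ≤ s n := fun n => hs0 ▸ hs (Nat.zero_le n)
    have ht' : ∀ n, OrderDual.ofDual (t n) ≤ b₀ := fun n => by
      have := ht (Nat.zero_le n)
      rw [ht0] at this
      exact this
    intro m n hmn
    dsimp only
    split_ifs with h1 h2 h2
    · exact hs (by omega)
    · omega
    · exact (ht' _).trans (hs' _)
    · exact ht (show (-n).toNat ≤ (-m).toNat by omega)
  · obtain ⟨n, hn⟩ := hsc x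
    exact ⟨n, by simpa using hn⟩
  · obtain ⟨n, hn⟩ := htc (OrderDual.toDual x)
    refine ⟨-n, ?_⟩
    have hn : OrderDual.ofDual (t n) ≤ x := hn
    rcases Nat.eq_zero_or_pos n with rfl | hpos
    · rw [ht0] at hn
      simpa [hs0] using hn
    · dsimp only
      rw [if_neg (by omega)]
      simpa using hn

theorem exists_int_interval {B : Type u} [LinearOrder B] {b : ℤ → B} (hb : Monotone b)
    (h1 : ∀ x, ∃ n, x ≤ b n) (h2 : ∀ x, ∃ n, b n ≤ x) (x : B) : ∃ n, b n ≤ x ∧ x ≤ b (n + 1) := by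
  obtain ⟨k, hk⟩ := h1 x
  by_cases hx : ∃ m, x < b m
  · obtain ⟨m, hm⟩ := hx
    obtain ⟨n, hn, hmax⟩ := Int.exists_greatest_of_bdd (P := fun n => b n ≤ x)
      ⟨m, fun z hz => (hb.reflect_lt (hz.trans_lt hm)).le⟩ (h2 x)
    refine ⟨n, hn, le_of_lt (not_le.1 fun hc => ?_)⟩
    have := hmax _ hc
    omega
  · push Not at hx
    exact ⟨k, hx k, hk.trans (hb (by omega))⟩

theorem exists_int_interval_of_strictMono {I : Type u} [LinearOrder I] {y : ℤ → I}
    (hy : StrictMono y) (h1 : ∀ x, ∃ n, x ≤ y n) (h2 : ∀ x, ∃ n, y n ≤ x) (i : I) :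
    ∃ n, y n ≤ i ∧ i < y (n + 1) := by
  obtain ⟨n, hn, hn'⟩ := exists_int_interval hy.monotone h1 h2 i
  rcases hn'.lt_or_eq with h | h
  · exact ⟨n, hn, h⟩
  · exact ⟨n + 1, h.ge, h ▸ hy (by omega)⟩

/-- A sum with cofinally and coinitially many strongly surjective summands containing `B` can be
mapped onto `B`. -/
theorem exists_epi_of_int_seq {I : Type v} [LinearOrder I] (A : I → LinOrd.{u}) {B : Type u}
    [LinearOrder B] [Nonempty B] {y : ℤ → I} (hy : StrictMono y) (hcof : ∀ i, ∃ n, i ≤ y n)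
    (hcoi : ∀ i, ∃ n, y n ≤ i) (hA : ∀ n, StronglySurjective (A (y n)))
    (hB : ∀ n, Embeds B (A (y n))) :
    ∃ f : ∀ i, A i → B, (∀ i, Monotone (f i)) ∧ (∀ i j, i < j → ∀ a a', f i a ≤ f j a') ∧
      ∀ x, ∃ i a, f i a = x := by
  obtain ⟨g⟩ := hB 0
  obtain ⟨b, hb, hbc, hbi⟩ := (hA 0).exists_int_seq g
  choose n hn hn' using exists_int_interval_of_strictMono hy hcof hcoi
  -- The summand at `y n` covers `[b n, b (n + 1)]`; all summands strictly between `y n` and `y (n +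
  -- 1)` are sent to `b (n + 1)`.
  have hloc : ∀ i, ∃ f : A i → B, Monotone f ∧ (∀ a, b (n i) ≤ f a ∧ f a ≤ b (n i + 1)) ∧
      (i ≠ y (n i) → ∀ a, f a = b (n i + 1)) ∧
      (i = y (n i) → ∀ x, b (n i) ≤ x → x ≤ b (n i + 1) → ∃ a, f a = x) := by
    intro i
    by_cases hi : i = y (n i)
    · obtain ⟨g⟩ := hB (n i)
      have hsA := hA (n i)
      rw [← hi] at g hsA
      have hle : b (n i) ≤ b (n i + 1) := hb (by omega)
      obtain ⟨f, hf, hfs⟩ := (hsA (Set.Icc (b (n i)) (b (n i + 1)))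
        ⟨(OrderEmbedding.subtype _).trans g⟩).resolve_left fun h => h.false ⟨_, le_rfl, hle⟩
      exact ⟨fun a => f a, fun a a' h => hf h, fun a => (f a).2, fun h => absurd hi h,
        fun _ x h1 h2 => (hfs ⟨x, h1, h2⟩).imp fun a ha => congrArg Subtype.val ha⟩
    · exact ⟨fun _ => b (n i + 1), monotone_const, fun _ => ⟨hb (by omega), le_rfl⟩,
        fun _ _ => rfl, fun h => absurd h hi⟩
  choose f hf hbd hconst hsurj using hloc
  refine ⟨f, hf, fun i j hij a a' => ?_, fun x => ?_⟩
  · rcases lt_trichotomy (n i) (n j) with h | h | h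
    · exact (hbd i a).2.trans ((hb (by omega)).trans (hbd j a').1)
    · rw [hconst j (fun hc => (hij.trans_le hc.le).not_ge (h ▸ hn i)) a', ← h]
      exact (hbd i a).2
    · have h1 : y (n j + 1) ≤ y (n i) := hy.monotone (by omega)
      exact absurd (hij.trans (hn' j)) ((h1.trans (hn i)).not_gt)
  · obtain ⟨m, hm1, hm2⟩ := exists_int_interval hb hbc hbi x
    have hnm : n (y m) = m := by
      have h1 := hy.le_iff_le.1 (hn (y m))
      have h2 := hy.lt_iff_lt.1 (hn' (y m))
      omega
    obtain ⟨a, ha⟩ := hsurj (y m) (by rw [hnm]) x (by rwa [hnm]) (by rwa [hnm])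
    exact ⟨y m, a, ha⟩

/-! ### Strongly surjective sums -/

/-- Every nonempty suborder `D` of `C` is the image of `C` under a monotone map all of whose fibers
have cofinally and coinitially many indices with the summand of their image. -/
def HasFatFibers {C : Type v} [LinearOrder C] (A : C → LinOrd.{u}) : Prop :=
  ∀ D : Set C, D.Nonempty → ∃ π : C → D, Monotone π ∧ ∀ d : D, ∃ y : ℤ → C, StrictMono y ∧
    (∀ n, π (y n) = d ∧ A (y n) = A d) ∧ (∀ c, π c = d → ∃ n, c ≤ y n) ∧
    ∀ c, π c = d → ∃ n, y n ≤ c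

/-- The fibre of `π` over `d` is mapped onto the part of `B` that lies in the summand `A d`;
monotonicity of `π` glues these maps. -/
theorem HasFatFibers.stronglySurjective {C : Type} [LinearOrder C] {A : C → LinOrd.{u}}
    (h : HasFatFibers A) (hA : ∀ c, StronglySurjective (A c)) :
    StronglySurjective (Σₗ c, A c) := by
  rintro B _ ⟨g⟩
  by_cases hB : IsEmpty B
  · exact Or.inl hB
  right
  rw [not_isEmpty_iff] at hB
  obtain ⟨b₀⟩ := hB
  obtain ⟨π, hπ, hfib⟩ := h {c | ∃ b, (g b).1 = c} ⟨_, b₀, rfl⟩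
  have key : ∀ d : {c | ∃ b, (g b).1 = c}, ∃ f : ∀ i : {c // π c = d}, A i → {b // (g b).1 = d.1},
      (∀ i, Monotone (f i)) ∧ (∀ i j, i < j → ∀ a a', f i a ≤ f j a') ∧
      ∀ x, ∃ i a, f i a = x := by
    intro d
    obtain ⟨y, hy, hyd, hcof, hcoi⟩ := hfib d
    have hne : Nonempty {b // (g b).1 = d.1} := by
      obtain ⟨b, hb⟩ := d.2
      exact ⟨⟨b, hb⟩⟩
    have hemb : Embeds {b // (g b).1 = d.1} (A d) := by
      refine ⟨OrderEmbedding.ofStrictMono (fun b => b.2 ▸ (g b.1).2) ?_⟩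
      rintro ⟨b, hb⟩ ⟨b', hb'⟩ hlt
      have hlt' : g b < g b' := g.strictMono hlt
      rw [Sigma.Lex.lt_def] at hlt'
      dsimp only
      have aux : ∀ (p q : Σₗ c, A c) (hp : p.1 = d.1) (hq : q.1 = d.1),
          (p.1 < q.1 ∨ ∃ h : p.1 = q.1, h ▸ p.2 < q.2) →
          (hp ▸ p.2 : A d.1) < (hq ▸ q.2 : A d.1) := by
        rintro ⟨c, a⟩ ⟨c', a'⟩ hp hq hpq
        dsimp only at hp hq hpq
        subst hp
        subst hq
        rcases hpq with hpq | ⟨_, hpq⟩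
        · exact absurd hpq (lt_irrefl _)
        · exact hpq
      exact aux _ _ hb hb' hlt'
    refine exists_epi_of_int_seq (fun i : {c // π c = d} => A i)
      (y := fun n => ⟨y n, (hyd n).1⟩) (fun m n hmn => hy hmn) (fun i => hcof i i.2)
      (fun i => hcoi i i.2) (fun n => hA _) fun n => ?_
    have := (hyd n).2
    dsimp only
    rw [this]
    exact hemb
  choose f hf hlt hsurj using key
  have hB : ∀ b b' : B, (g b).1 < (g b').1 → b ≤ b' := fun b b' h => by
    have : g b < g b' := Sigma.Lex.lt_def.2 (Or.inl h)
    exact (g.lt_iff_lt.1 this).le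
  refine ⟨fun p => (f (π p.1) ⟨p.1, rfl⟩ p.2).1, ?_, fun b => ?_⟩
  · have aux : ∀ (d) (p q : Σₗ c, A c) (hp : π p.1 = d) (hq : π q.1 = d), p ≤ q →
        (f d ⟨p.1, hp⟩ p.2).1 ≤ (f d ⟨q.1, hq⟩ q.2).1 := by
      intro d p q hp hq hpq
      rw [Sigma.Lex.le_def] at hpq
      rcases hpq with hpq | ⟨he, hpq⟩
      · exact hlt d ⟨p.1, hp⟩ ⟨q.1, hq⟩ hpq p.2 q.2
      · obtain ⟨c, a⟩ := p
        obtain ⟨c', a'⟩ := q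
        dsimp only at he hpq hp hq ⊢
        subst he
        exact hf d ⟨c, hp⟩ hpq
    have aux' : ∀ (d) (p : Σₗ c, A c) (hp : π p.1 = d),
        (f (π p.1) ⟨p.1, rfl⟩ p.2).1 = (f d ⟨p.1, hp⟩ p.2).1 := by
      rintro d p rfl
      rfl
    intro p q hpq
    have h1 : p.1 ≤ q.1 := (Sigma.Lex.le_def.1 hpq).elim le_of_lt fun h => h.1.le
    rcases (hπ h1).lt_or_eq with h2 | h2
    · refine hB _ _ ?_
      rw [(f (π p.1) ⟨p.1, rfl⟩ p.2).2, (f (π q.1) ⟨q.1, rfl⟩ q.2).2]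
      exact h2
    · dsimp only
      rw [aux' _ p h2]
      exact aux _ p q h2 rfl hpq
  · obtain ⟨⟨c, hc⟩, a, ha⟩ := hsurj ⟨(g b).1, b, rfl⟩ ⟨b, rfl⟩
    have aux' : ∀ (d) (c : C) (hc : π c = d) (a : A c),
        (f (π c) ⟨c, rfl⟩ a).1 = (f d ⟨c, hc⟩ a).1 := by
      rintro d c rfl a
      rfl
    exact ⟨toLex ⟨c, a⟩, (aux' _ c hc a).trans (congrArg Subtype.val ha)⟩

/-! ### The normal Countryman line -/

namespace CohPoint

/-- A point with a single nonzero coordinate. -/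
noncomputable def root : CohPoint where
  val ξ := open Classical in if ξ = ⊥ then 1 else 0
  ht := ⊥
  zero_iff ξ := by simp [bot_lt_iff_ne_bot]
  coh := by simp

theorem prefixFree_singleton (d : CohPoint) : PrefixFree {d} := by
  rintro _ rfl _ rfl _
  rfl

variable {D : Set CohPoint} {d l r x y : CohPoint}

theorem exists_gt_of_ht (hD : PrefixFree D) (hl : l ∈ fatten D) {β : OmegaOne} (hβ : β ≤ l.ht) :
    ∃ w ∈ fatten D, Agree β w l ∧ l < w := by
  obtain ⟨G, hG⟩ := exists_isCofBound D
  obtain ⟨γ, hγ, hlt⟩ := exists_closurePoint_gt G β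
  obtain ⟨b, -, hb⟩ := exists_right hD hG hγ hl hlt hβ
  obtain ⟨w, h1, h2, h3, -⟩ := hb _ (Order.lt_succ b) ⊥ bot_le
  exact ⟨w, h1, h2, h3⟩

theorem exists_lt_of_ht (hD : PrefixFree D) (hl : l ∈ fatten D) {β : OmegaOne} (hβ : β ≤ l.ht) :
    ∃ w ∈ fatten D, Agree β w l ∧ w < l := by
  obtain ⟨G, hG⟩ := exists_isCofBound D
  obtain ⟨γ, hγ, hlt⟩ := exists_closurePoint_gt G β
  obtain ⟨b, -, hb⟩ := exists_left hD hG hγ hl hlt hβ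
  obtain ⟨w, h1, h2, h3, -⟩ := hb _ (Order.lt_succ b) ⊥ bot_le
  exact ⟨w, h1, h2, h3⟩

theorem exists_between_of_ht (hD : PrefixFree D) (hl : l ∈ fatten D) (hr : r ∈ fatten D)
    (hlr : l < r) : ∃ b, ∀ h, b < h → ∀ a ≤ h, ∃ w ∈ fatten D, l < w ∧ w < r ∧ w.ht = h ∧
      colour w = a := by
  obtain ⟨δ, -, hδ⟩ := exists_diff hlr.ne
  obtain ⟨G, hG⟩ := exists_isCofBound D
  obtain ⟨γ, hγ, hlt⟩ := exists_closurePoint_gt G δ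
  obtain ⟨b, -, hb⟩ := exists_middle hD hG hγ hl hr hlr fun hc => hδ (hc δ hlt)
  refine ⟨b, fun h hh a ha => ?_⟩
  obtain ⟨w, h1, h2, h3, -, -, h4⟩ := hb h hh a ha
  exact ⟨w, h1, h2, h3, h4⟩

theorem exists_colour_between (hD : PrefixFree D) (l r : fatten D) (hlr : l < r) (a : OmegaOne) :
    ∃ w : fatten D, l < w ∧ w < r ∧ colour (w : CohPoint) = a := by
  obtain ⟨b, hb⟩ := exists_between_of_ht hD l.2 r.2 hlr
  obtain ⟨w, hw, h1, h2, -, h3⟩ := hb (max (Order.succ b) a)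
    (lt_max_of_lt_left (Order.lt_succ b)) a (le_max_right _ _)
  exact ⟨⟨w, hw⟩, h1, h2, h3⟩

theorem exists_over_of_colour {v : ℚ} (hv : NonInt v) (d : CohPoint) (a : OmegaOne) :
    ∃ w, IsOver d w ∧ w.val (Order.succ d.ht) = v ∧ colour w = a := by
  obtain ⟨w, h1, h2, -, h3⟩ := exists_over_succ (d := d) hv
    (lt_max_of_lt_left (c := a) (Order.lt_succ (Order.succ d.ht))) (le_max_right _ _)
  exact ⟨w, h1, h2, h3⟩

theorem isCardDense_fatten (hD : PrefixFree D) (hne : D.Nonempty) :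
    IsCardDense ℵ₁ (fatten D) := by
  obtain ⟨d, hd⟩ := hne
  obtain ⟨w, hw, -⟩ := exists_over_of_colour (nonInt_nat_add_half 0) d ⊥
  refine ⟨⟨⟨w, d, hd, hw⟩⟩, ⟨fun l => ?_⟩, ⟨fun l => ?_⟩, fun l r hlr => ?_⟩
  · obtain ⟨w, hw, -, h⟩ := exists_lt_of_ht hD l.2 bot_le
    exact ⟨⟨w, hw⟩, h⟩
  · obtain ⟨w, hw, -, h⟩ := exists_gt_of_ht hD l.2 bot_le
    exact ⟨⟨w, hw⟩, h⟩
  · refine le_antisymm ((Cardinal.mk_set_le _).trans ((Cardinal.mk_set_le _).trans mk_le)) ?_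
    rw [← Cardinal.succ_aleph0, Order.succ_le_iff, ← not_le, Cardinal.le_aleph0_iff_set_countable]
    intro hc
    obtain ⟨b, hb⟩ := exists_between_of_ht hD l.2 r.2 hlr
    refine not_countable_Ioi b ((hc.image fun w => (w : CohPoint).ht).mono fun h hh => ?_)
    obtain ⟨w, hw, h1, h2, h3, -⟩ := hb h hh ⊥ bot_le
    exact ⟨⟨w, hw⟩, ⟨le_of_lt h1, le_of_lt h2⟩, h3⟩

theorem le_ht_of_agree {β : OmegaOne} (hD : PrefixFree D) {u : CohPoint} (hu : u ∈ fatten D)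
    (hl : l ∈ fatten D) (hβ : β ≤ l.ht) (h : Agree β u l) : β ≤ u.ht := by
  by_contra! hc
  have := hD.fatten u hu l hl (h.mono (Order.succ_le_of_lt hc))
  exact (this ▸ hc).not_ge hβ

/-- The decomposition is by height. Near a point of height at least `ξ` its node of level `ξ` has
points on both sides, and prefix-freeness makes all points of that node at least as high as `ξ`. -/
theorem isNonStationary_fatten (hD : PrefixFree D) : IsNonStationary (fatten D) := by
  let rk : OmegaOne → Set.Iio (ω₁ : Ordinal.{0}) := (Ordinal.ToType.mk (o := ω₁)).symm
  have hrk : ∀ (a : OmegaOne) (ξ : Ordinal.{0}) (hξ : ξ < ω₁),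
      (rk a : Ordinal.{0}) < ξ ↔ a < Ordinal.ToType.mk ⟨ξ, hξ⟩ := by
    intro a ξ hξ
    rw [← OrderIso.symm_apply_lt]
    rfl
  refine ⟨fun ξ => {c | (rk (c : CohPoint).ht : Ordinal.{0}) < ξ}, ⟨fun ξ hξ => ?_,
    fun ξ η hle _ => ?_, fun ξ hξ hlim => ?_, fun c => ?_⟩,
    fun ξ hξ I hI => ?_⟩
  · simp only [hrk _ ξ hξ]
    exact (countable_ht_lt (Ordinal.ToType.mk ⟨ξ, hξ⟩)).preimage Subtype.val_injective
  · intro c hc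
    rw [Set.mem_ofPred_eq] at hc ⊢
    exact lt_of_lt_of_le hc hle
  · ext c
    simp only [Set.mem_iUnion, Set.mem_ofPred_eq, exists_prop]
    constructor
    · intro hc
      exact ⟨_, hlim.succ_lt hc, Order.lt_succ _⟩
    · rintro ⟨η, hη, hc⟩
      exact lt_trans hc hη
  · refine ⟨rk (Order.succ (c : CohPoint).ht), (rk _).2, ?_⟩
    exact (Ordinal.ToType.mk (o := ω₁)).symm.strictMono (Order.lt_succ (c : CohPoint).ht)
  · obtain ⟨⟨-, hconv, hdisj⟩, hmax⟩ := hI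
    have hht : ∀ c : fatten D, Ordinal.ToType.mk ⟨ξ, hξ⟩ ≤ (c : CohPoint).ht ↔
        c ∉ {c : fatten D | (rk (c : CohPoint).ht : Ordinal.{0}) < ξ} := fun c => by
      rw [← not_lt, ← hrk _ ξ hξ]
      rfl
    constructor
    · rintro ⟨a, haI, hale⟩
      have ha := (hht a).2 (Set.disjoint_left.1 hdisj haI)
      obtain ⟨w, hw, hag, hlt⟩ := exists_lt_of_ht hD a.2 ha
      -- The interval extended down to `w` still avoids the low points, so by maximality it contains
      -- nothing new, although `w` lies below the supposed minimum.
      have hsub := hmax (y := {u | ⟨w, hw⟩ ≤ u ∧ (u ≤ a ∨ u ∈ I)}) ⟨⟨a, hlt.le, Or.inl le_rfl⟩,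
        ⟨fun x hx z hz t ht => ⟨hx.1.trans ht.1, ?_⟩⟩, Set.disjoint_left.2 fun u hu => ?_⟩
        fun u hu => ⟨le_trans (le_of_lt hlt) (hale hu), Or.inr hu⟩
      · exact absurd (hale (hsub (show (⟨w, hw⟩ : fatten D) ∈ _ from ⟨le_rfl, Or.inl hlt.le⟩)))
          (not_le.2 hlt)
      · rcases le_or_gt t a with h | h
        · exact Or.inl h
        · have hz' := hz.2.resolve_left (not_le.2 (h.trans_le ht.2))
          exact Or.inr (hconv.out haI hz' ⟨h.le, ht.2⟩)
      · rcases hu.2 with h | h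
        · rw [← hht]
          have := hag.of_le_of_le (y := (u : CohPoint)) hu.1 h
          exact le_ht_of_agree hD u.2 a.2 ha (this.symm.trans hag)
        · exact Set.disjoint_left.1 hdisj h
    · rintro ⟨a, haI, hale⟩
      have ha := (hht a).2 (Set.disjoint_left.1 hdisj haI)
      obtain ⟨w, hw, hag, hlt⟩ := exists_gt_of_ht hD a.2 ha
      have hsub := hmax (y := {u | u ≤ ⟨w, hw⟩ ∧ (a ≤ u ∨ u ∈ I)}) ⟨⟨a, hlt.le, Or.inl le_rfl⟩,
        ⟨fun x hx z hz t ht => ⟨ht.2.trans hz.1, ?_⟩⟩, Set.disjoint_left.2 fun u hu => ?_⟩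
        fun u hu => ⟨le_trans (hale hu) (le_of_lt hlt), Or.inr hu⟩
      · exact absurd (hale (hsub (show (⟨w, hw⟩ : fatten D) ∈ _ from ⟨le_rfl, Or.inl hlt.le⟩)))
          (not_le.2 hlt)
      · rcases le_or_gt a t with h | h
        · exact Or.inl h
        · have hx' := hx.2.resolve_left (not_le.2 (ht.1.trans_lt h))
          exact Or.inr (hconv.out hx' haI ⟨ht.1, h.le⟩)
      · rcases hu.2 with h | h
        · rw [← hht]
          have := hag.symm.of_le_of_le (y := (u : CohPoint)) h hu.1
          exact le_ht_of_agree hD u.2 a.2 ha this.symm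
        · exact Set.disjoint_left.1 hdisj h

theorem isCountrymanLine_fatten (hD : PrefixFree D) (hne : D.Nonempty) :
    IsCountrymanLine (fatten D) := by
  refine ⟨?_, squareSigmaChain.subtype _⟩
  obtain ⟨⟨a⟩, -, h, hcard⟩ := isCardDense_fatten hD hne
  obtain ⟨b, hab⟩ := h.exists_gt a
  rw [← Cardinal.aleph0_lt_mk_iff]
  refine lt_of_lt_of_le ?_ (Cardinal.mk_set_le (Set.Icc a b))
  rw [hcard a b hab]
  exact Cardinal.aleph0_lt_aleph_one

theorem isNormalLine_fatten (hD : PrefixFree D) (hne : D.Nonempty) : IsNormalLine (fatten D) := by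
  have := (isCountrymanLine_fatten hD hne).1
  exact ⟨(squareSigmaChain.subtype _).isAronszajnLine, isNonStationary_fatten hD,
    isCardDense_fatten hD hne⟩

/-- The projection of a fattened set onto its base. -/
theorem exists_projection (hD : PrefixFree D) : ∃ π : fatten D → D, Monotone π ∧
    ∀ d : D, ∃ y : ℤ → fatten D, StrictMono y ∧
      (∀ n, π (y n) = d ∧ colour (y n : CohPoint) = colour (d : CohPoint)) ∧
      (∀ c, π c = d → ∃ n, c ≤ y n) ∧ ∀ c, π c = d → ∃ n, y n ≤ c := by
  choose π hπD hπ using fun y : fatten D => y.2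
  have hunique : ∀ (y : fatten D) (d) (hd : d ∈ D), IsOver d y → π y = d := fun y d hd hy =>
    (hπ y).unique hD (hπD y) hd hy Agree.refl
  refine ⟨fun y => ⟨π y, hπD y⟩, fun x y hxy => ?_, fun d => ?_⟩
  · by_contra hc
    exact (hD.lt_of_lt (hπD y) (hπD x) (hπ y) (hπ x) (not_le.1 hc)).not_ge hxy
  -- Extensions of `d` with value `n + 1/2` right after `d` and with the colour of `d` run through
  -- the whole fibre in both directions.
  · choose y hy hyv hyc using fun n => exists_over_of_colour (nonInt_int_add_half n) d (colour d)
    have hyd : ∀ n, π ⟨y n, d, d.2, hy n⟩ = d := fun n => hunique ⟨y n, d, d.2, hy n⟩ d d.2 (hy n)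
    have hcmp : ∀ {u w : CohPoint}, IsOver (d : CohPoint) u → IsOver (d : CohPoint) w →
        u.val (Order.succ (d : CohPoint).ht) < w.val (Order.succ (d : CohPoint).ht) → u < w :=
      fun hu hw h => lt_iff.2 ⟨_, hu.agree.trans hw.agree.symm, h⟩
    have hover : ∀ c : fatten D, (⟨π c, hπD c⟩ : D) = d → IsOver (d : CohPoint) c := by
      rintro c rfl
      exact hπ c
    refine ⟨fun n => ⟨y n, d, d.2, hy n⟩, fun m n hmn => hcmp (hy m) (hy n) ?_,
      fun n => ⟨Subtype.ext (hyd n), hyc n⟩, fun c hc => ?_, fun c hc => ?_⟩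
    · rw [hyv, hyv]
      have : (m : ℚ) < n := by exact_mod_cast hmn
      linarith
    · refine ⟨⌈(c : CohPoint).val (Order.succ (d : CohPoint).ht)⌉, le_of_lt (hcmp (hover c hc) (hy _) ?_)⟩
      rw [hyv]
      linarith [Int.le_ceil ((c : CohPoint).val (Order.succ (d : CohPoint).ht))]
    · refine ⟨⌊(c : CohPoint).val (Order.succ (d : CohPoint).ht)⌋ - 1,
        le_of_lt (hcmp (hy _) (hover c hc) ?_)⟩
      rw [hyv]
      push_cast
      linarith [Int.floor_le ((c : CohPoint).val (Order.succ (d : CohPoint).ht))]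

/-- A subset `E` of a fattened set is itself prefix-free, so `fatten D ≅ fatten E`, and the
projection onto `E` supplies the fibres. -/
theorem hasFatFibers (hMA : MartinsAxiom ℵ₁) (hD : PrefixFree D) (hne : D.Nonempty)
    (A : OmegaOne → LinOrd.{u}) : HasFatFibers fun c : fatten D => A (colour (c : CohPoint)) := by
  intro E hE
  have hE' : PrefixFree (Subtype.val '' E : Set CohPoint) := by
    rintro _ ⟨x, -, rfl⟩ _ ⟨y, -, rfl⟩ h
    exact hD.fatten x x.2 y y.2 h
  obtain ⟨f, hf⟩ := exists_colour_iso hMA hD hE' hne (hE.image _)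
  obtain ⟨π, hπ, hfib⟩ := exists_projection hE'
  have hmem : ∀ d : (Subtype.val '' E : Set CohPoint), ∃ h : (d : CohPoint) ∈ fatten D,
      (⟨d, h⟩ : fatten D) ∈ E := by
    rintro ⟨_, x, hx, rfl⟩
    exact ⟨x.2, hx⟩
  choose h hh using hmem
  refine ⟨fun c => ⟨⟨π (f c), h _⟩, hh _⟩, fun a b hab => hπ (f.monotone hab), ?_⟩
  rintro ⟨d, hd⟩
  obtain ⟨y, hy, hyd, hc1, hc2⟩ := hfib ⟨d, d, hd, rfl⟩
  have hiff : ∀ c, (⟨⟨π (f c), h _⟩, hh _⟩ : E) = ⟨d, hd⟩ ↔ π (f c) = ⟨d, d, hd, rfl⟩ := by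
    intro c
    simp only [Subtype.ext_iff]
  refine ⟨fun n => f.symm (y n), f.symm.strictMono.comp hy, fun n => ⟨?_, ?_⟩, fun c hc => ?_,
    fun c hc => ?_⟩
  · rw [hiff, f.apply_symm_apply]
    exact (hyd n).1
  · have h1 := hf (f.symm (y n))
    rw [f.apply_symm_apply] at h1
    dsimp only
    rw [← h1, (hyd n).2]
  · obtain ⟨n, hn⟩ := hc1 (f c) ((hiff c).1 hc)
    exact ⟨n, f.le_symm_apply.2 hn⟩
  · obtain ⟨n, hn⟩ := hc2 (f c) ((hiff c).1 hc)
    exact ⟨n, f.symm_apply_le.2 hn⟩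

end CohPoint

/-! ### The main theorem -/

theorem exists_surjection_omegaOne {ι : Type v} [Nonempty ι] (h : #ι ≤ ℵ₁) :
    ∃ κ : OmegaOne → ι, Function.Surjective κ := by
  have h1 : Cardinal.lift.{0} #ι ≤ Cardinal.lift.{v} #OmegaOne := by
    rw [OmegaOne.mk_eq]
    simpa using h
  obtain ⟨e⟩ := Cardinal.lift_mk_le'.1 h1
  exact ⟨Function.invFun e, Function.invFun_surjective e.injective⟩

theorem stronglySurjective_of_subsingleton {A : Type u} [LinearOrder A] [Subsingleton A] :
    StronglySurjective A := by
  rintro B _ ⟨g⟩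
  by_cases hB : IsEmpty B
  · exact Or.inl hB
  obtain ⟨b⟩ := not_isEmpty_iff.1 hB
  have := g.injective.subsingleton
  exact Or.inr ⟨fun _ => b, monotone_const, fun b' => ⟨g b, Subsingleton.elim _ _⟩⟩

/-- The nonempty members are listed along `ω₁`, with repetitions; if there are none, one-point
orders fill the sum. -/
theorem exists_summands {ι : Type v} (F : ι → LinOrd.{u}) (hι : #ι ≤ ℵ₁)
    (hF : ∀ i, StronglySurjective (F i)) :
    ∃ A : OmegaOne → LinOrd.{u}, (∀ a, Nonempty (A a)) ∧ (∀ a, StronglySurjective (A a)) ∧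
      (∀ i, Nonempty (F i) → ∃ a, A a = F i) ∧ ((∃ i, Nonempty (F i)) → ∀ a, ∃ i, A a = F i) ∧
      ∀ a, #(A a) ≤ max ℵ₁ (⨆ i, #(F i)) := by
  by_cases hne : ∃ i, Nonempty (F i)
  · have : Nonempty {i // Nonempty (F i)} := nonempty_subtype.2 hne
    obtain ⟨κ, hκ⟩ := exists_surjection_omegaOne
      ((Cardinal.mk_subtype_le fun i => Nonempty (F i)).trans hι)
    have : Nonempty ι := hne.nonempty
    -- This enumeration of all of `ι` only provides smallness, so that the supremum of the cardinals
    -- is taken over a bounded family.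
    obtain ⟨κ', hκ'⟩ := exists_surjection_omegaOne hι
    have : Small.{u} ι := small_of_surjective hκ'
    refine ⟨fun a => F (κ a), fun a => (κ a).2, fun a => hF _, fun i hi => ?_,
      fun _ a => ⟨_, rfl⟩, fun a => le_max_of_le_right ?_⟩
    · obtain ⟨a, ha⟩ := hκ ⟨i, hi⟩
      exact ⟨a, congrArg (fun j => F j.1) ha⟩
    · exact le_ciSup (f := fun i => #(F i)) Cardinal.bddAbove_of_small _
  · refine ⟨fun _ => LinOrd.of PUnit, fun _ => inferInstanceAs (Nonempty PUnit),
      fun _ => stronglySurjective_of_subsingleton (A := PUnit), fun i hi => absurd ⟨i, hi⟩ hne,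
      fun h => absurd h hne, fun _ => le_max_of_le_left ?_⟩
    have : #(LinOrd.of PUnit.{u + 1}) = 1 := Cardinal.mk_punit
    rw [this]
    exact Cardinal.one_le_aleph0.trans (Cardinal.aleph0_le_aleph 1)

theorem mk_sum_eq {C : Type} [LinearOrder C] (hC : #C = ℵ₁) (A : C → LinOrd.{u})
    (hA : ∀ c, Nonempty (A c)) {M : Cardinal.{u}} (hM : ∀ c, #(A c) ≤ max ℵ₁ M)
    (hM' : M ≤ #(Σₗ c, A c)) : #(Σₗ c, A c) = max ℵ₁ M := by
  have h1 : #(Σₗ c, A c) = Cardinal.sum fun c => #(A c) := Cardinal.mk_sigma _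
  refine le_antisymm ?_ (max_le ?_ hM')
  · rw [h1]
    refine (Cardinal.sum_le_sum _ (fun _ => max ℵ₁ M) hM).trans ?_
    rw [Cardinal.sum_const, hC]
    have h0 : ℵ₀ ≤ max ℵ₁ M := (Cardinal.aleph0_le_aleph 1).trans (le_max_left _ _)
    simpa using Cardinal.mul_le_of_le h0 (le_max_left _ _) le_rfl
  · rw [h1]
    refine le_trans ?_ (Cardinal.sum_le_sum (fun _ => 1) _ fun c =>
      Cardinal.one_le_iff_ne_zero.2 (Cardinal.mk_ne_zero_iff.2 (hA c)))
    rw [Cardinal.sum_const, hC]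
    simp

theorem embeds_summand {C : Type} [LinearOrder C] (A : C → LinOrd.{u}) (c : C) :
    Embeds (A c) (Σₗ c, A c) :=
  ⟨OrderEmbedding.ofStrictMono (fun a => toLex ⟨c, a⟩) fun _ _ h =>
    Sigma.Lex.lt_def.2 (Or.inr ⟨rfl, h⟩)⟩

theorem mainTheorem12 (hMA : MartinsAxiom ℵ₁)
    {ι : Type v} (F : ι → LinOrd.{u}) (hι : #ι ≤ ℵ₁) (hF : ∀ i, StronglySurjective (F i)) :
    ∃ (C : Type) (_ : LinearOrder C), IsCountrymanLine C ∧ IsNormalLine C ∧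
      ∃ A : C → LinOrd.{u}, IsMixed A ∧
        (∀ i, Nonempty (F i) → ∃ c, A c = F i) ∧
        ((∃ i, Nonempty (F i)) → ∀ c, ∃ i, A c = F i) ∧
        StronglySurjective (Σₗ c, A c) ∧
        #(Σₗ c, A c) = max ℵ₁ (⨆ i, #(F i)) ∧
        ∀ i, Embeds (F i) (Σₗ c, A c) := by
  have hD := CohPoint.prefixFree_singleton CohPoint.root
  have hne : ({CohPoint.root} : Set CohPoint).Nonempty := Set.singleton_nonempty _
  obtain ⟨A, hA, hAs, hAF, hFA, hAM⟩ := exists_summands F hι hF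
  have hC := CohPoint.isCountrymanLine_fatten hD hne
  have hN := CohPoint.isNormalLine_fatten hD hne
  have hsurj : ∀ a, ∃ c : CohPoint.fatten {CohPoint.root}, CohPoint.colour (c : CohPoint) = a := by
    intro a
    obtain ⟨w, h1, -, h2⟩ := CohPoint.exists_over_of_colour (nonInt_nat_add_half 0) CohPoint.root a
    exact ⟨⟨w, _, rfl, h1⟩, h2⟩
  have hcard : #(CohPoint.fatten {CohPoint.root}) = ℵ₁ := by
    refine le_antisymm ((Cardinal.mk_set_le _).trans CohPoint.mk_le) ?_
    rw [← Cardinal.succ_aleph0, Order.succ_le_iff, Cardinal.aleph0_lt_mk_iff]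
    exact hC.1
  let B := fun c : CohPoint.fatten {CohPoint.root} => A (CohPoint.colour (c : CohPoint))
  have hBF : ∀ i, Nonempty (F i) → ∃ c, B c = F i := fun i hi => by
    obtain ⟨a, ha⟩ := hAF i hi
    obtain ⟨c, rfl⟩ := hsurj a
    exact ⟨c, ha⟩
  have hemb : ∀ i, Embeds (F i) (Σₗ c, B c) := by
    intro i
    rcases isEmpty_or_nonempty (F i) with hi | hi
    · exact ⟨OrderEmbedding.ofStrictMono (fun a => (hi.false a).elim) fun a => (hi.false a).elim⟩
    · obtain ⟨c, hc⟩ := hBF i hi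
      rw [← hc]
      exact embeds_summand B c
  refine ⟨CohPoint.fatten {CohPoint.root}, inferInstance, hC, hN, B, ⟨⟨fun x y hxy => ?_⟩,
    fun c => hA _, fun c x y hxy => ?_⟩, hBF, fun h c => hFA h _,
    (CohPoint.hasFatFibers hMA hD hne A).stronglySurjective fun c => hAs _, ?_, hemb⟩
  · obtain ⟨w, h1, h2, -⟩ := CohPoint.exists_colour_between hD x y hxy ⊥
    exact ⟨w, h1, h2⟩
  · obtain ⟨w, h1, h2, h3⟩ := CohPoint.exists_colour_between hD x y hxy (CohPoint.colour (c : CohPoint))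
    exact ⟨w, h1, h2, congrArg A h3.symm⟩
  · refine mk_sum_eq hcard B (fun c => hA _) (fun c => hAM _) (ciSup_le' fun i => ?_)
    obtain ⟨g⟩ := hemb i
    exact Cardinal.mk_le_of_injective g.injective
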